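/- Let $T>0$ and let $(X,d_t)_{t\in[0,T]}$ be a family of complete geodesic metric spaces on a common set $X$ for which there is a constant $L$ with $|\log(d_t(x,y)/d_s(x,y))|\le L|t-s|$ for all $s,t\in[0,T]$ and $x\ne y$. Let $\sigma$ be a topology on $X$ that is weaker than the topology induced by the $d_t$ and such that each $d_t$ is sequentially $\sigma$-lower semicontinuous, i.e. $x_n\overset{\sigma}\rightharpoonup x$ and $y_n\overset{\sigma}\rightharpoonup y$ imply $d_t(x,y)\le\liminf_n d_t(x_n,y_n)$. Let $E:[0,T]\times X\to(-\infty,\infty]$ satisfy: - (A1) $\mathrm{Dom}(E)=\{x: E_t(x)<\infty\}$ is nonempty and independent of $t$; - (A2) for each $t$, $E_t$ is bounded from below; - (A3*) for each $t$, $E_t$ is sequentially $\sigma$-lower semicontinuous; - (A4) there is $L^*$ with $|E_t(x)-E_s(x)|\le L^*|t-s|$ for all $s,t\in[0,T]$, $x\in\mathrm{Dom}(E)$, and there is a set of times of full measure in $[0,T]$ at which $t\mapsto E_t(x)$ is differentiable for every $x\in\mathrm{Dom}(E)$; - (A5) every sequence $(x_n)\subset X$ with $\sup_{n,m}d_t(x_n,x_m)<\infty$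 for some $t$ has a $\sigma$-convergent subsequence. For $x\in\mathrm{Dom}(E)$ let $|\nabla_sE_t|(x)=\limsup_{y\to x}[E_t(x)-E_t(y)]^+/d_s(x,y)$ be the slope of $E_t$ with respect to $d_s$. Assume moreover, for points of $\mathrm{Dom}(E)$: - for a.e. $t$: if $x_n\overset{\sigma}\rightharpoonup x$, then $\limsup_n(\partial_tE_t)(x_n)\le(\partial_tE_t)(x)$; - if $t_n\to t$ in $[0,T]$ and $x_n\overset{\sigma}\rightharpoonup x$, then $|\nabla_tE_t|^2(x)\le\liminf_n|\nabla_{t_n}E_t|^2(x_n)$. Let $\bar x\in\mathrm{Dom}(E)$. For a step $h>0$ put $t_n=nh$, with the convention $E_t=E_T$, $d_t=d_T$ for $t>T$. Let $x^h_0=\bar x$ and, as long as $t_{n-1}<T$, let $x^h_n$ be a minimizer of $x\mapsto E_{t_n}(x)+\frac1{2h}d^2_{t_n}(x,x^h_{n-1})$. The discrete solution is $\bar x^h_0=\bar x$, $\bar x^h_t=x^h_n$ for $t\in(t_{n-1},t_n]$; a variational interpolation is a map $\tilde x^h$ with $\tilde x^h_0=\bar x$ such that, for $t\in(t_{n-1},t_n]$,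 $t\le T$, the point $\tilde x^h_t$ minimizes $x\mapsto E_t(x)+\frac1{2(t-t_{n-1})}d^2_{t_n}(x,x^h_{n-1})$. A curve $(x_t)_{t\in[0,T]}$ is a limit curve if there are $h_k\downarrow0$ and such $\bar x^{h_k},\tilde x^{h_k}$ with $\bar x^{h_k}_t\overset{\sigma}\rightharpoonup x_t$ and $\tilde x^{h_k}_t\overset{\sigma}\rightharpoonup x_t$ for all $t\in[0,T]$. Then every limit curve $(x_t)$ belongs to $\mathrm{AC}^2([0,T];X)$ (for each $t^*\in[0,T]$ there is $g\in L^2(0,T)$ with $d_{t^*}(x_s,x_t)\le\int_s^tg(r)\,dr$ for $0\le s\le t\le T$), the function $r\mapsto(\partial_rE_r)(x_r)$ is integrable on $(0,T)$, and for every $t\in[0,T]$ $$E_t(x_t)+\frac12\int_0^t|\dot x|_r^2\,dr+\frac12\int_0^t|\nabla_rE_r|^2(x_r)\,dr\le E_0(\bar x)+\int_0^t(\partial_rE_r)(x_r)\,dr .$$ Here $|\dot x|_t=\frac{d}{dt}L_x(t)$ is the derivative of the length $L_x(t)=\lim_{h\to0}\sup\{\sum_i d_{p_i}(x_{p_i},x_{p_{i+1}}):0=p_0<\dots<p_n=t,\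 p_{i+1}-p_i\le h\}$, and the slope integral is the upper Lebesgue integral (the usual integral whenever the integrand is measurable). -/

import Mathlib

open Filter Topology MeasureTheory Set
open scoped ENNReal

noncomputable section

namespace DynGradFlow

/-! Throughout, `M t` is the metric structure `d_t` on `X` (only `t ∈ [0,T]` matters), and the
topology `σ` is the ambient `TopologicalSpace X` instance, so that `Tendsto u atTop (𝓝 x)` means
`σ`-convergence. The metric structures `M t` are never instances. -/

/-- The distance `d_t(x,y)`. -/
def tdist {X : Type*} (M : ℝ → MetricSpace X) (t : ℝ) (x y : X) : ℝ :=
  @dist X (M t).toPseudoMetricSpace.toDist x y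

/-- The topology induced by `d_t`. -/
abbrev metricTop {X : Type*} (M : ℝ → MetricSpace X) (t : ℝ) : TopologicalSpace X :=
  (M t).toPseudoMetricSpace.toUniformSpace.toTopologicalSpace

/-- `(X, d_t)`, `t ∈ [0,T]`, is a family of complete geodesic metric spaces such that
`t ↦ log d_t(x,y)` is Lipschitz uniformly in `x, y`. -/
structure IsTimeDependentMetric {X : Type*} (T : ℝ) (M : ℝ → MetricSpace X) : Prop where
  complete : ∀ t ∈ Icc 0 T, @CompleteSpace X (M t).toPseudoMetricSpace.toUniformSpace
  geodesic : ∀ t ∈ Icc 0 T, ∀ x y : X, ∃ γ : ℝ → X, γ 0 = x ∧ γ 1 = y ∧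
    ∀ a ∈ Icc (0 : ℝ) 1, ∀ b ∈ Icc (0 : ℝ) 1, tdist M t (γ a) (γ b) = |a - b| * tdist M t x y
  logLip : ∃ L : ℝ, ∀ s ∈ Icc 0 T, ∀ t ∈ Icc 0 T, ∀ x y : X, x ≠ y →
    |Real.log (tdist M t x y / tdist M s x y)| ≤ L * |t - s|

/-- `σ` is weaker than the topologies of the `d_t`, and each `d_t` is sequentially
`σ`-lower semicontinuous. -/
structure IsCompatibleTopology {X : Type*} [TopologicalSpace X] (T : ℝ)
    (M : ℝ → MetricSpace X) : Prop where
  weaker : ∀ t ∈ Icc 0 T, ∀ U : Set X, IsOpen U → IsOpen[metricTop M t] U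
  dist_lsc : ∀ t ∈ Icc 0 T, ∀ (u v : ℕ → X) (x y : X),
    Tendsto u atTop (𝓝 x) → Tendsto v atTop (𝓝 y) →
    (tdist M t x y : EReal) ≤ liminf (fun n => (tdist M t (u n) (v n) : EReal)) atTop

/-- The time-independent domain `Dom(E) = {E_0 < ∞}`. -/
def dom {X : Type*} (E : ℝ → X → EReal) : Set X := {x | E 0 x < ⊤}

/-- A1: `Dom(E_t)` is nonempty and does not depend on `t`. -/
def A1 {X : Type*} (T : ℝ) (E : ℝ → X → EReal) : Prop :=
  (dom E).Nonempty ∧ ∀ t ∈ Icc 0 T, {x | E t x < ⊤} = dom E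

/-- A2: each `E_t` is bounded from below (in particular it never equals `-∞`). -/
def A2 {X : Type*} (T : ℝ) (E : ℝ → X → EReal) : Prop :=
  ∀ t ∈ Icc 0 T, ∃ c : ℝ, ∀ x, (c : EReal) ≤ E t x

/-- A3*: each `E_t` is sequentially `σ`-lower semicontinuous. -/
def A3star {X : Type*} [TopologicalSpace X] (T : ℝ) (E : ℝ → X → EReal) : Prop :=
  ∀ t ∈ Icc 0 T, ∀ (u : ℕ → X) (x : X), Tendsto u atTop (𝓝 x) →
    E t x ≤ liminf (fun n => E t (u n)) atTop

/-- A4: `t ↦ E_t(x)` is Lipschitz on `[0,T]` uniformly in `x ∈ Dom(E)`, and there is one set of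
times of full measure at which it is differentiable for every `x ∈ Dom(E)`. -/
def A4 {X : Type*} (T : ℝ) (E : ℝ → X → EReal) : Prop :=
  (∃ Lstar : ℝ, ∀ s ∈ Icc 0 T, ∀ t ∈ Icc 0 T, ∀ x ∈ dom E,
    |(E t x).toReal - (E s x).toReal| ≤ Lstar * |t - s|) ∧
  ∀ᵐ t ∂volume.restrict (Icc 0 T), ∀ x ∈ dom E,
    DifferentiableWithinAt ℝ (fun s => (E s x).toReal) (Icc 0 T) t

/-- A5: every `d_t`-bounded sequence has a `σ`-convergent subsequence. -/
def A5 {X : Type*} [TopologicalSpace X] (T : ℝ) (M : ℝ → MetricSpace X) : Prop :=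
  ∀ t ∈ Icc 0 T, ∀ u : ℕ → X, (∃ C : ℝ, ∀ n m, tdist M t (u n) (u m) ≤ C) →
    ∃ (x : X) (φ : ℕ → ℕ), StrictMono φ ∧ Tendsto (u ∘ φ) atTop (𝓝 x)

/-- `(∂_t E_t)(x)`, for `t ∈ [0,T]` and `x ∈ Dom(E)`. -/
def timeDeriv {X : Type*} (T : ℝ) (E : ℝ → X → EReal) (t : ℝ) (x : X) : ℝ :=
  derivWithin (fun s => (E s x).toReal) (Icc 0 T) t

/-- The slope `|∇_s E_t|(x) = limsup_{y → x} [E_t(x) - E_t(y)]⁺ / d_s(x,y)` of `E_t` with respect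
to `d_s`, for `x ∈ Dom(E)`; `EReal.toENNReal` is the positive part. -/
def slope {X : Type*} (M : ℝ → MetricSpace X) (E : ℝ → X → EReal) (s t : ℝ) (x : X) : ℝ≥0∞ :=
  limsup (fun y => (E t x - E t y).toENNReal / ENNReal.ofReal (tdist M s x y))
    (@nhdsWithin X (metricTop M s) x {x}ᶜ)

/-- `x ∈ AC^2([0,T];X)`. -/
def IsAC2 {X : Type*} (T : ℝ) (M : ℝ → MetricSpace X) (x : ℝ → X) : Prop :=
  ∀ tstar ∈ Icc 0 T, ∃ g : ℝ → ℝ, MemLp g 2 (volume.restrict (Ioo 0 T)) ∧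
    ∀ s t : ℝ, 0 ≤ s → s ≤ t → t ≤ T → tdist M tstar (x s) (x t) ≤ ∫ r in s..t, g r

/-- `p 0 < p 1 < ⋯ < p n` is a partition of `[0,t]` of mesh at most `h`. -/
def IsPartition (t h : ℝ) (n : ℕ) (p : ℕ → ℝ) : Prop :=
  p 0 = 0 ∧ p n = t ∧ ∀ i < n, p i < p (i + 1) ∧ p (i + 1) - p i ≤ h

/-- The length `L_x(t)`: the limit as `h ↓ 0` (an infimum, by monotonicity in `h`) of the supremum
of `∑ d_{p_i}(x_{p_i}, x_{p_{i+1}})` over the partitions of `[0,t]` of mesh at most `h`. -/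
def length {X : Type*} (M : ℝ → MetricSpace X) (x : ℝ → X) (t : ℝ) : ℝ≥0∞ :=
  ⨅ (h : ℝ) (_ : 0 < h), ⨆ (n : ℕ) (p : ℕ → ℝ) (_ : IsPartition t h n p),
    ∑ i ∈ Finset.range n, ENNReal.ofReal (tdist M (p i) (x (p i)) (x (p (i + 1))))

/-- The instantaneous speed `|ẋ|_t`, the derivative of the length. -/
def speed {X : Type*} (M : ℝ → MetricSpace X) (x : ℝ → X) (t : ℝ) : ℝ :=
  deriv (fun s => (length M x s).toReal) t

/-- `(X_n)` is a sequence of minimizers of the scheme with time step `h` and initial value `xbar`: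
`X_{n+1}` minimizes `E_{t_{n+1}} + d_{t_{n+1}}^2(·, X_n) / (2h)`, `t_n = n h`, as long as `t_n < T`.
The last node may exceed `T`; there `E` and `d` are frozen at time `T`. -/
def IsMinimizingSequence {X : Type*} (T : ℝ) (M : ℝ → MetricSpace X) (E : ℝ → X → EReal)
    (xbar : X) (h : ℝ) (S : ℕ → X) : Prop :=
  S 0 = xbar ∧ ∀ n : ℕ, n * h < T →
    IsMinOn (fun y => E (min ((n + 1) * h) T) y +
      ((1 / (2 * h) * tdist M (min ((n + 1) * h) T) y (S n) ^ 2 : ℝ) : EReal)) univ (S (n + 1))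

/-- The discrete solution: `S n` on `((n-1)h, nh]` and `S 0` at time `0`. -/
def discreteSolution {X : Type*} (h : ℝ) (S : ℕ → X) (t : ℝ) : X := S ⌈t / h⌉₊

/-- `z` is a variational interpolation of `(S n)`: for `t = nh + r ∈ (nh, (n+1)h]`, `t ≤ T`, the
point `z t` minimizes `E_t + d_{(n+1)h}^2(·, S n) / (2r)`. -/
def IsVariationalInterpolation {X : Type*} (T : ℝ) (M : ℝ → MetricSpace X) (E : ℝ → X → EReal)
    (h : ℝ) (S : ℕ → X) (z : ℝ → X) : Prop :=
  z 0 = S 0 ∧ ∀ (n : ℕ) (t : ℝ), n * h < t → t ≤ (n + 1) * h → t ≤ T →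
    IsMinOn (fun y => E t y +
      ((1 / (2 * (t - n * h)) * tdist M (min ((n + 1) * h) T) y (S n) ^ 2 : ℝ) : EReal))
      univ (z t)

/-- `x` is a limit curve of the minimizing movement scheme started in `xbar`: along time steps
`h_k ↓ 0`, discrete solutions and variational interpolations `σ`-converge to `x` at all times. -/
def IsLimitCurve {X : Type*} [TopologicalSpace X] (T : ℝ) (M : ℝ → MetricSpace X)
    (E : ℝ → X → EReal) (xbar : X) (x : ℝ → X) : Prop :=
  ∃ (h : ℕ → ℝ) (S : ℕ → ℕ → X) (z : ℕ → ℝ → X),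
    (∀ k, 0 < h k) ∧ Tendsto h atTop (𝓝 0) ∧
    (∀ k, IsMinimizingSequence T M E xbar (h k) (S k)) ∧
    (∀ k, IsVariationalInterpolation T M E (h k) (S k) (z k)) ∧
    ∀ t ∈ Icc 0 T, Tendsto (fun k => discreteSolution (h k) (S k) t) atTop (𝓝 (x t)) ∧
      Tendsto (fun k => z k t) atTop (𝓝 (x t))

/-- The upper integral of a nonnegative function. It is the Lebesgue integral if `f` is
a.e.-measurable, and it dominates `∫⁻` (a lower integral) in general. It is used for the slope term,
whose measurability in time is not part of the assumptions. -/
def upperLIntegral {α : Type*} [MeasurableSpace α] (μ : Measure α) (f : α → ℝ≥0∞) : ℝ≥0∞ :=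
  ⨅ (g : α → ℝ≥0∞) (_ : Measurable g) (_ : ∀ᵐ a ∂μ, f a ≤ g a), ∫⁻ a, g a ∂μ

theorem upperLIntegral_eq_lintegral {α : Type*} [MeasurableSpace α] (μ : Measure α)
    (f : α → ℝ≥0∞) (hf : AEMeasurable f μ) : upperLIntegral μ f = ∫⁻ a, f a ∂μ := by
  apply le_antisymm
  · refine iInf_le_of_le (hf.mk f) (iInf_le_of_le hf.measurable_mk (iInf_le_of_le ?_ ?_))
    · exact hf.ae_eq_mk.le
    · exact (lintegral_congr_ae hf.ae_eq_mk).ge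
  · exact le_iInf fun g => le_iInf fun _ => le_iInf fun hg => lintegral_mono_ae hg

end DynGradFlow

end

/-! ### Functions with increments controlled by a monotone function -/

/-! The proof compares minimizers and extracts two monotone functions of time; the only
differentiation used is that of monotone functions.

Let `K ≥ 0` be a Lipschitz constant of the energy in time. Along a variational interpolation `z`,
the quantity Ψ = `interpolationGain` (`K t` minus energy, minus current penalty, minus action of the
earlier steps) is nondecreasing: a longer time relaxes the penalty, and `K t` absorbs the drift of
the energy. So Ψ is differentiable a.e., and the integral of Ψ' is at most the increment of Ψ.
Freezing the competitor `z r` gives a smooth function touching Ψ from below at `r`, hence Ψ'(r) = K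
− ∂_rE_r(z_r) + ½(d/τ)², where d/τ dominates the slope at `z r` (`ae_le_deriv_interpolationGain`).
No regularity of `z` in time enters. Since K − ∂_rE ≥ 0, Fatou's lemma and the two semicontinuity
hypotheses yield in the limit ∫(K − ∂_rE) + ½∫*|∇E|² ≤ K t + E_0(x̄) − E_t(x_t) − a, where `a` is
the limit of the actions (`exists_lintegral_liminf_deriv_le`).

For the speed, twice the discrete actions converge along a fixed ultrafilter to a nondecreasing `e`,
and d_a(x_a, x_b) ≤ exp(L(b−a)) √((b−a)(e b − e a)). On fine partitions the exponential factors tend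
to 1 and Cauchy–Schwarz sums the roots, so the length has increments at most √((b−a)(e b − e a))
(`abs_length_sub_le`). Hence |ẋ|² ≤ e' a.e., which gives AC² and ½∫|ẋ|² ≤ a. Adding the two
estimates, `a` and `K t` cancel. -/

theorem MonotoneOn.sum_sub_le_of_pairwiseDisjoint {ι : Type*} {f : ℝ → ℝ} {A B : ℝ}
    (hf : MonotoneOn f (Icc A B)) (hAB : A ≤ B) (s : Finset ι) (a b : ι → ℝ)
    (hab : ∀ i ∈ s, A ≤ a i ∧ a i ≤ b i ∧ b i ≤ B)
    (hd : (s : Set ι).PairwiseDisjoint fun i => Ioc (a i) (b i)) :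
    ∑ i ∈ s, (f (b i) - f (a i)) ≤ f B - f A := by
  classical
  -- Induction on the interval with the largest right end: disjointness forces all other intervals
  -- to the left of its left end, which becomes the new `B'`. Empty intervals would break this
  -- argument, so they are discarded beforehand.
  have key : ∀ s : Finset ι, ∀ B' ∈ Icc A B, (∀ i ∈ s, A ≤ a i ∧ a i < b i ∧ b i ≤ B') →
      (s : Set ι).PairwiseDisjoint (fun i => Ioc (a i) (b i)) →
      ∑ i ∈ s, (f (b i) - f (a i)) ≤ f B' - f A := by
    intro s
    induction s using Finset.induction_on_max_value b with
    | empty =>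
      intro B' hB' _ _
      simpa using hf ⟨le_rfl, hAB⟩ hB' hB'.1
    | insert i s hi hmax ih =>
      intro B' hB' hs hd
      have hi' := hs i (Finset.mem_insert_self i s)
      have hAi : a i ∈ Icc A B := ⟨hi'.1, by linarith [hB'.2]⟩
      have hBi : b i ∈ Icc A B := ⟨by linarith, by linarith [hB'.2]⟩
      rw [Finset.sum_insert hi]
      have h1 := ih (a i) hAi (fun j hj => ?_) (hd.subset (by simp))
      · have h2 := hf hBi hB' hi'.2.2
        linarith
      · have hj' := hs j (Finset.mem_insert_of_mem hj)
        refine ⟨hj'.1, hj'.2.1, ?_⟩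
        have hne : i ≠ j := fun h => hi (h ▸ hj)
        have hdisj := hd (by simp : i ∈ ((insert i s : Finset ι) : Set ι)) (by simp [hj]) hne
        by_contra! hlt
        exact Set.disjoint_left.1 hdisj (⟨hlt, hmax j hj⟩ : b j ∈ Ioc (a i) (b i)) ⟨hj'.2.1, le_rfl⟩
  have hsub : ∑ i ∈ s.filter (fun i => a i < b i), (f (b i) - f (a i))
      = ∑ i ∈ s, (f (b i) - f (a i)) := by
    refine Finset.sum_subset (Finset.filter_subset _ _) fun i hi hni => ?_
    have : ¬ a i < b i := fun h => hni (Finset.mem_filter.2 ⟨hi, h⟩)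
    rw [le_antisymm (hab i hi).2.1 (not_lt.1 this), sub_self]
  rw [← hsub]
  refine key _ B ⟨hAB, le_rfl⟩ (fun i hi => ?_) (hd.subset fun i hi => ?_)
  · have := Finset.mem_filter.1 hi
    exact ⟨(hab i this.1).1, this.2, (hab i this.1).2.2⟩
  · exact (Finset.mem_filter.1 hi).1

/-- Cauchy–Schwarz, in the form that makes bounds √(length · increment of `e`) stable under
subdivision. -/
theorem Finset.sum_sqrt_mul_le {ι : Type*} (s : Finset ι) (u v : ι → ℝ)
    (hu : ∀ i ∈ s, 0 ≤ u i) (hv : ∀ i ∈ s, 0 ≤ v i) :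
    ∑ i ∈ s, √(u i * v i) ≤ √((∑ i ∈ s, u i) * ∑ i ∈ s, v i) := by
  refine Real.le_sqrt_of_sq_le ?_
  refine Finset.sum_sq_le_sum_mul_sum_of_sq_le_mul s hu hv fun i hi => ?_
  exact (Real.sq_sqrt (mul_nonneg (hu i hi) (hv i hi))).le

/-- `e` may jump; the smallness comes from the other factor. Over disjoint intervals Cauchy–Schwarz
bounds the variation of `l` by the root of the total length times `e T - e 0`. -/
theorem absolutelyContinuousOnInterval_of_sub_le_sqrt {T : ℝ} (hT : 0 ≤ T) {l e : ℝ → ℝ}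
    (he : MonotoneOn e (Icc 0 T))
    (hl : ∀ a b, 0 ≤ a → a ≤ b → b ≤ T → |l b - l a| ≤ √((b - a) * (e b - e a))) :
    AbsolutelyContinuousOnInterval l 0 T := by
  rw [absolutelyContinuousOnInterval_iff]
  intro ε hε
  set K := e T - e 0 with hK
  have hK0 : 0 ≤ K := sub_nonneg.2 (he ⟨le_rfl, hT⟩ ⟨hT, le_rfl⟩ hT)
  refine ⟨ε ^ 2 / (K + 1), by positivity, ?_⟩
  rintro ⟨n, I⟩ ⟨hI, hd⟩ hlen
  simp only [uIcc_of_le hT] at hI hlen hd ⊢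
  set a : ℕ → ℝ := fun i => min (I i).1 (I i).2
  set b : ℕ → ℝ := fun i => max (I i).1 (I i).2
  have hab : ∀ i ∈ Finset.range n, 0 ≤ a i ∧ a i ≤ b i ∧ b i ≤ T := fun i hi =>
    ⟨le_min (hI i hi).1.1 (hI i hi).2.1, min_le_max, max_le (hI i hi).1.2 (hI i hi).2.2⟩
  have hdist : ∀ i, dist (I i).1 (I i).2 = b i - a i := fun i => by
    rw [Real.dist_eq, max_sub_min_eq_abs']
  have hldist : ∀ i ∈ Finset.range n,
      dist (l (I i).1) (l (I i).2) ≤ √((b i - a i) * (e (b i) - e (a i))) := by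
    intro i hi
    have h := hl (a i) (b i) (hab i hi).1 (hab i hi).2.1 (hab i hi).2.2
    rcases le_total (I i).1 (I i).2 with h' | h'
    · have ha : a i = (I i).1 := min_eq_left h'
      have hb : b i = (I i).2 := max_eq_right h'
      rw [ha, hb] at h ⊢
      rwa [dist_comm, Real.dist_eq]
    · have ha : a i = (I i).2 := min_eq_right h'
      have hb : b i = (I i).1 := max_eq_left h'
      rw [ha, hb] at h ⊢
      rwa [Real.dist_eq]
  have hsum := he.sum_sub_le_of_pairwiseDisjoint hT (Finset.range n) a b hab hd
  have hnn : ∀ i ∈ Finset.range n, 0 ≤ e (b i) - e (a i) := fun i hi =>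
    sub_nonneg.2 (he ⟨(hab i hi).1, (hab i hi).2.1.trans (hab i hi).2.2⟩
      ⟨(hab i hi).1.trans (hab i hi).2.1, (hab i hi).2.2⟩ (hab i hi).2.1)
  have hlen' : ∑ i ∈ Finset.range n, (b i - a i) < ε ^ 2 / (K + 1) := by
    simpa only [hdist] using hlen
  have hlen0 : 0 ≤ ∑ i ∈ Finset.range n, (b i - a i) :=
    Finset.sum_nonneg fun i hi => sub_nonneg.2 (hab i hi).2.1
  calc ∑ i ∈ Finset.range n, dist (l (I i).1) (l (I i).2)
      ≤ ∑ i ∈ Finset.range n, √((b i - a i) * (e (b i) - e (a i))) := Finset.sum_le_sum hldist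
    _ ≤ √((∑ i ∈ Finset.range n, (b i - a i)) * ∑ i ∈ Finset.range n, (e (b i) - e (a i))) :=
        Finset.sum_sqrt_mul_le _ _ _ (fun i hi => sub_nonneg.2 (hab i hi).2.1) hnn
    _ < ε := by
        rw [Real.sqrt_lt' hε]
        calc _ ≤ (∑ i ∈ Finset.range n, (b i - a i)) * (K + 1) := by
              gcongr; linarith
          _ < ε ^ 2 / (K + 1) * (K + 1) := by gcongr
          _ = ε ^ 2 := by field_simp

theorem MonotoneOn.deriv_nonneg_of_mem_Ioo {f : ℝ → ℝ} {a b r : ℝ} (hf : MonotoneOn f (Icc a b))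
    (hr : r ∈ Ioo a b) : 0 ≤ deriv f r := by
  rw [← derivWithin_of_mem_nhds (Icc_mem_nhds hr.1 hr.2)]
  exact hf.derivWithin_nonneg

theorem MonotoneOn.ae_differentiableAt_Ioo {f : ℝ → ℝ} {a b : ℝ} (hf : MonotoneOn f (Icc a b)) :
    ∀ᵐ r, r ∈ Ioo a b → DifferentiableAt ℝ f r := by
  filter_upwards [hf.ae_differentiableWithinAt_of_mem] with r hr hr'
  exact (hr (Ioo_subset_Icc_self hr')).differentiableAt (Icc_mem_nhds hr'.1 hr'.2)

/-- The squared difference quotient of `l` is at most the difference quotient of `e`. Where `l` is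
not differentiable its `deriv` is 0, and monotonicity of `e` suffices. -/
theorem ae_deriv_sq_le_of_sub_le_sqrt {T : ℝ} {l e : ℝ → ℝ}
    (he : MonotoneOn e (Icc 0 T))
    (hl : ∀ a b, 0 ≤ a → a ≤ b → b ≤ T → |l b - l a| ≤ √((b - a) * (e b - e a))) :
    ∀ᵐ r, r ∈ Ioo 0 T → deriv l r ^ 2 ≤ deriv e r := by
  filter_upwards [he.ae_differentiableAt_Ioo] with r hr hr'
  by_cases hd : DifferentiableAt ℝ l r
  · have h1 := hd.hasDerivAt.hasDerivWithinAt (s := Ioi r)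
    have h2 := (hr hr').hasDerivAt.hasDerivWithinAt (s := Ioi r)
    rw [hasDerivWithinAt_iff_tendsto_slope' self_notMem_Ioi] at h1 h2
    refine le_of_tendsto_of_tendsto (h1.pow 2) h2 ?_
    filter_upwards [Ioo_mem_nhdsGT hr'.2] with s hs
    have hpos : 0 < s - r := sub_pos.2 hs.1
    have hle := hl r s hr'.1.le hs.1.le hs.2.le
    have hee : 0 ≤ e s - e r := sub_nonneg.2
      (he ⟨hr'.1.le, hr'.2.le⟩ ⟨(hr'.1.trans hs.1).le, hs.2.le⟩ hs.1.le)
    have hsq : (l s - l r) ^ 2 ≤ (s - r) * (e s - e r) := by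
      rw [← sq_abs]
      calc |l s - l r| ^ 2 ≤ √((s - r) * (e s - e r)) ^ 2 := by gcongr
        _ = _ := Real.sq_sqrt (by positivity)
    rw [slope_def_field, slope_def_field, div_pow, div_le_div_iff₀ (by positivity) hpos]
    nlinarith
  · rw [deriv_zero_of_not_differentiableAt hd]
    simpa using he.deriv_nonneg_of_mem_Ioo hr'

/-- Jumps and singular parts of a monotone function only enlarge its increment. This replaces the
fundamental theorem of calculus for Ψ and `e`, which may be discontinuous. -/
theorem MonotoneOn.lintegral_ofReal_deriv_le {f : ℝ → ℝ} {a b : ℝ} (hab : a ≤ b)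
    (hf : MonotoneOn f (Icc a b)) :
    ∫⁻ r in Ioc a b, ENNReal.ofReal (deriv f r) ≤ ENNReal.ofReal (f b - f a) := by
  have hf' : MonotoneOn f (uIcc a b) := by rwa [uIcc_of_le hab]
  have hi := (intervalIntegrable_iff_integrableOn_Ioc_of_le hab).1 hf'.intervalIntegrable_deriv
  have hnn : 0 ≤ᵐ[volume.restrict (Ioc a b)] deriv f := by
    rw [← restrict_Ioo_eq_restrict_Ioc]
    filter_upwards [ae_restrict_mem measurableSet_Ioo] with r hr
    exact hf.deriv_nonneg_of_mem_Ioo hr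
  rw [← ofReal_integral_eq_lintegral_ofReal hi hnn, ← intervalIntegral.integral_of_le hab]
  have h := hf'.intervalIntegral_deriv_mem_uIcc
  rw [uIcc_of_le (sub_nonneg.2 (hf ⟨le_rfl, hab⟩ ⟨hab, le_rfl⟩ hab))] at h
  exact ENNReal.ofReal_le_ofReal h.2

namespace DynGradFlow

variable {X : Type*} {T L : ℝ} {M : ℝ → MetricSpace X}

/-! ### The time-dependent metric -/

theorem tdist_self (t : ℝ) (x : X) : tdist M t x x = 0 :=
  @dist_self X (M t).toPseudoMetricSpace x

theorem tdist_comm (t : ℝ) (x y : X) : tdist M t x y = tdist M t y x :=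
  @dist_comm X (M t).toPseudoMetricSpace x y

theorem tdist_nonneg (t : ℝ) (x y : X) : 0 ≤ tdist M t x y :=
  @dist_nonneg X (M t).toPseudoMetricSpace x y

theorem tdist_triangle (t : ℝ) (x y z : X) : tdist M t x z ≤ tdist M t x y + tdist M t y z :=
  @dist_triangle X (M t).toPseudoMetricSpace x y z

theorem tdist_pos (t : ℝ) {x y : X} (h : x ≠ y) : 0 < tdist M t x y :=
  (@dist_pos X (M t) x y).2 h

theorem tdist_le_range_sum (t : ℝ) (f : ℕ → X) (n : ℕ) :
    tdist M t (f 0) (f n) ≤ ∑ i ∈ Finset.range n, tdist M t (f i) (f (i + 1)) :=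
  @dist_le_range_sum_dist X (M t).toPseudoMetricSpace f n

theorem IsTimeDependentMetric.exists_tdist_le (hM : IsTimeDependentMetric T M) :
    ∃ L : ℝ, 0 ≤ L ∧ ∀ s ∈ Icc 0 T, ∀ t ∈ Icc 0 T, ∀ x y : X,
      tdist M t x y ≤ Real.exp (L * |t - s|) * tdist M s x y := by
  obtain ⟨L, hL⟩ := hM.logLip
  refine ⟨|L|, abs_nonneg L, fun s hs t ht x y => ?_⟩
  rcases eq_or_ne x y with rfl | hxy
  · simp [tdist_self]
  · have hspos := tdist_pos (M := M) s hxy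
    have htpos := tdist_pos (M := M) t hxy
    have h1 : Real.log (tdist M t x y / tdist M s x y) ≤ |L| * |t - s| :=
      (le_abs_self _).trans ((hL s hs t ht x y hxy).trans
        (mul_le_mul_of_nonneg_right (le_abs_self L) (abs_nonneg _)))
    rw [Real.log_le_iff_le_exp (by positivity), div_le_iff₀ hspos] at h1
    exact h1

/-! ### Length of curves -/

theorem IsPartition.mono {t h : ℝ} {n : ℕ} {p : ℕ → ℝ} (hp : IsPartition t h n p) {i j : ℕ}
    (hij : i ≤ j) (hj : j ≤ n) : p i ≤ p j := by
  induction j, hij using Nat.le_induction with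
  | base => exact le_rfl
  | succ k _ ih => exact (ih (by omega)).trans (hp.2.2 k (by omega)).1.le

theorem IsPartition.mem_Icc {t h : ℝ} {n : ℕ} {p : ℕ → ℝ} (hp : IsPartition t h n p) {i : ℕ}
    (hi : i ≤ n) : p i ∈ Icc 0 t := by
  refine ⟨?_, ?_⟩
  · have := hp.mono (Nat.zero_le i) hi
    rwa [hp.1] at this
  · have := hp.mono hi le_rfl
    rwa [hp.2.1] at this

theorem isPartition_zero (h : ℝ) : IsPartition 0 h 0 fun _ => 0 :=
  ⟨rfl, rfl, fun i hi => absurd hi (Nat.not_lt_zero i)⟩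

theorem IsPartition.exists_append {a b h : ℝ} {n : ℕ} {p : ℕ → ℝ} (hp : IsPartition a h n p)
    (hab : a ≤ b) (hh : 0 < h) :
    ∃ (m : ℕ) (q : ℕ → ℝ), IsPartition b h (n + m) q ∧ ∀ i ≤ n, q i = p i := by
  rcases hab.eq_or_lt with rfl | hab
  · exact ⟨0, p, hp, fun i _ => rfl⟩
  set N := ⌈(b - a) / h⌉₊ with hN
  have hba : 0 < b - a := sub_pos.2 hab
  have hN0 : 0 < N := Nat.ceil_pos.2 (by positivity)
  have hN0' : (0 : ℝ) < N := Nat.cast_pos.2 hN0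
  set δ := (b - a) / N with hδ
  have hδ0 : 0 < δ := by positivity
  have hδh : δ ≤ h := by
    rw [hδ, div_le_iff₀ hN0', ← div_le_iff₀' hh]
    exact Nat.le_ceil _
  set q : ℕ → ℝ := fun i => if i ≤ n then p i else a + ((i : ℝ) - n) * δ with hq
  have hq1 : ∀ i ≤ n, q i = p i := fun i hi => by simp [hq, hi]
  have hq2 : ∀ i, n ≤ i → q i = a + ((i : ℝ) - n) * δ := fun i hi => by
    rcases hi.eq_or_lt with rfl | hi
    · simp [hq, hp.2.1]
    · simp [hq, not_le.2 hi]
  refine ⟨N, q, ⟨?_, ?_, fun i _ => ?_⟩, hq1⟩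
  · rw [hq1 0 (Nat.zero_le n), hp.1]
  · rw [hq2 _ (Nat.le_add_right n N), hδ]
    push_cast
    field_simp
    ring
  · rcases lt_or_ge i n with hi | hi
    · rw [hq1 i hi.le, hq1 (i + 1) hi]
      exact hp.2.2 i hi
    · rw [hq2 i hi, hq2 (i + 1) (by omega)]
      push_cast
      constructor <;> nlinarith

/-- The supremum of the lengths over the partitions of `[0,t]` of mesh at most `h`. -/
noncomputable def meshLength (M : ℝ → MetricSpace X) (x : ℝ → X) (h t : ℝ) : ℝ≥0∞ :=
  ⨆ (n : ℕ) (p : ℕ → ℝ) (_ : IsPartition t h n p),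
    ∑ i ∈ Finset.range n, ENNReal.ofReal (tdist M (p i) (x (p i)) (x (p (i + 1))))

theorem length_eq_iInf_meshLength (x : ℝ → X) (t : ℝ) :
    length M x t = ⨅ (h : ℝ) (_ : 0 < h), meshLength M x h t := rfl

theorem length_le_meshLength (x : ℝ → X) {h : ℝ} (hh : 0 < h) (t : ℝ) :
    length M x t ≤ meshLength M x h t :=
  iInf₂_le h hh

theorem IsPartition.sum_le_meshLength {t h : ℝ} {n : ℕ} {p : ℕ → ℝ} (hp : IsPartition t h n p)
    (x : ℝ → X) :
    ∑ i ∈ Finset.range n, ENNReal.ofReal (tdist M (p i) (x (p i)) (x (p (i + 1))))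
      ≤ meshLength M x h t :=
  le_iSup_of_le n (le_iSup_of_le p (le_iSup_of_le hp le_rfl))

theorem meshLength_mono (x : ℝ → X) {h h' : ℝ} (hh : h ≤ h') (t : ℝ) :
    meshLength M x h t ≤ meshLength M x h' t :=
  iSup_le fun _ => iSup_le fun _ => iSup_le fun hp =>
    IsPartition.sum_le_meshLength
      ⟨hp.1, hp.2.1, fun i hi => ⟨(hp.2.2 i hi).1, (hp.2.2 i hi).2.trans hh⟩⟩ x

theorem length_zero (x : ℝ → X) : length M x 0 = 0 := by
  refine le_antisymm ((length_le_meshLength x one_pos 0).trans ?_) zero_le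
  refine iSup_le fun n => iSup_le fun p => iSup_le fun hp => ?_
  rcases Nat.eq_zero_or_pos n with rfl | hn
  · simp
  · have h1 := (hp.2.2 0 hn).1
    have h2 := hp.mono (i := 1) (j := n) hn le_rfl
    rw [hp.1] at h1
    rw [hp.2.1] at h2
    simp only [zero_add] at h1
    linarith

/-- Any partition of `[0,a]` extends to one of `[0,b]`, and the triangle inequality applies on the
added part. Freezing the distances at time `t` costs a factor `exp (L * T)`, which is harmless for
monotonicity of the length and for AC². -/
theorem meshLength_add_le (hL0 : 0 ≤ L) (hL : ∀ s ∈ Icc 0 T, ∀ t ∈ Icc 0 T, ∀ x y : X,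
      tdist M t x y ≤ Real.exp (L * |t - s|) * tdist M s x y)
    (x : ℝ → X) {a b t h : ℝ} (ha : 0 ≤ a) (hab : a ≤ b) (hb : b ≤ T)
    (ht : t ∈ Icc 0 T) (hh : 0 < h) :
    meshLength M x h a + ENNReal.ofReal (Real.exp (-(L * T)) * tdist M t (x a) (x b))
      ≤ meshLength M x h b := by
  set c := ENNReal.ofReal (Real.exp (-(L * T)) * tdist M t (x a) (x b)) with hc
  have key : ∀ n p, IsPartition a h n p →
      ∑ i ∈ Finset.range n, ENNReal.ofReal (tdist M (p i) (x (p i)) (x (p (i + 1)))) + c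
        ≤ meshLength M x h b := by
    intro n p hp
    obtain ⟨m, q, hq, hqp⟩ := hp.exists_append hab hh
    refine le_trans ?_ (hq.sum_le_meshLength x)
    rw [Finset.sum_range_add]
    refine add_le_add (le_of_eq (Finset.sum_congr rfl fun i hi => ?_)) ?_
    · have hi := Finset.mem_range.1 hi
      rw [hqp i hi.le, hqp (i + 1) hi]
    · rw [← ENNReal.ofReal_sum_of_nonneg fun i _ => tdist_nonneg _ _ _]
      refine ENNReal.ofReal_le_ofReal ?_
      have h1 := tdist_le_range_sum (M := M) t (fun i => x (q (n + i))) m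
      simp only [add_zero] at h1
      rw [hqp n le_rfl, hp.2.1, hq.2.1] at h1
      calc Real.exp (-(L * T)) * tdist M t (x a) (x b)
          ≤ Real.exp (-(L * T)) *
              ∑ i ∈ Finset.range m, tdist M t (x (q (n + i))) (x (q (n + (i + 1)))) := by gcongr
        _ = ∑ i ∈ Finset.range m,
              Real.exp (-(L * T)) * tdist M t (x (q (n + i))) (x (q (n + (i + 1)))) :=
            Finset.mul_sum _ _ _
        _ ≤ _ := by
            refine Finset.sum_le_sum fun i hi => ?_
            have hi := Finset.mem_range.1 hi
            have hqi := hq.mem_Icc (i := n + i) (by omega)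
            have h2 := hL (q (n + i)) ⟨hqi.1, hqi.2.trans hb⟩ t ht (x (q (n + i)))
              (x (q (n + i + 1)))
            have h3 : |t - q (n + i)| ≤ T := by
              rw [abs_le]
              constructor <;> linarith [hqi.1, hqi.2, ht.1, ht.2]
            rw [Real.exp_neg, inv_mul_le_iff₀ (Real.exp_pos _)]
            refine h2.trans ?_
            have := tdist_nonneg (M := M) (q (n + i)) (x (q (n + i))) (x (q (n + i + 1)))
            gcongr
  -- Subtracting `c` is truncated in `ℝ≥0∞`, so this bound is needed separately in case the supremum
  -- over partitions of `[0,a]` is empty.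
  have hcb : c ≤ meshLength M x h b := by
    obtain ⟨n, q, hq, -⟩ := (isPartition_zero h).exists_append ha hh
    exact le_trans le_add_self (key _ _ hq)
  refine add_le_of_le_tsub_right_of_le hcb ?_
  exact iSup_le fun n => iSup_le fun p => iSup_le fun hp =>
    ENNReal.le_sub_of_add_le_right ENNReal.ofReal_ne_top (key n p hp)

theorem length_add_le (hL0 : 0 ≤ L) (hL : ∀ s ∈ Icc 0 T, ∀ t ∈ Icc 0 T, ∀ x y : X,
      tdist M t x y ≤ Real.exp (L * |t - s|) * tdist M s x y)
    (x : ℝ → X) {a b t : ℝ} (ha : 0 ≤ a) (hab : a ≤ b) (hb : b ≤ T)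
    (ht : t ∈ Icc 0 T) :
    length M x a + ENNReal.ofReal (Real.exp (-(L * T)) * tdist M t (x a) (x b))
      ≤ length M x b := by
  rw [length_eq_iInf_meshLength x b]
  refine le_iInf₂ fun h hh => le_trans ?_ (meshLength_add_le hL0 hL x ha hab hb ht hh)
  gcongr
  exact length_le_meshLength x hh a

/-- A partition of `[0,b]` is cut at `a` into the nodes `min (p i) a` and `max (p i) a`; degenerate
pieces contribute 0. One factor `exp (L * h)` pays for changing the metric on the piece straddling
`a`, the other comes from `hx` on steps of length at most `h`. -/
theorem meshLength_le_add (hL0 : 0 ≤ L) (hL : ∀ s ∈ Icc 0 T, ∀ t ∈ Icc 0 T, ∀ x y : X,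
      tdist M t x y ≤ Real.exp (L * |t - s|) * tdist M s x y) {e : ℝ → ℝ} {x : ℝ → X}
    (he : MonotoneOn e (Icc 0 T)) (hx : ∀ a b, 0 ≤ a → a ≤ b → b ≤ T →
      tdist M a (x a) (x b) ≤ Real.exp (L * (b - a)) * √((b - a) * (e b - e a)))
    {a b h : ℝ} (ha : 0 ≤ a) (hab : a ≤ b) (hb : b ≤ T) :
    meshLength M x h b ≤ meshLength M x h a
      + ENNReal.ofReal (Real.exp (2 * L * h) * √((b - a) * (e b - e a))) := by
  refine iSup_le fun n => iSup_le fun p => iSup_le fun hp => ?_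
  set q : ℕ → ℝ := fun i => min (p i) a with hq
  set r : ℕ → ℝ := fun i => max (p i) a with hr
  have hpT : ∀ i ≤ n, p i ∈ Icc 0 T := fun i hi =>
    ⟨(hp.mem_Icc hi).1, (hp.mem_Icc hi).2.trans hb⟩
  have haT : a ∈ Icc 0 T := ⟨ha, hab.trans hb⟩
  have hrT : ∀ i ≤ n, r i ∈ Icc 0 T := fun i hi =>
    ⟨ha.trans (le_max_right _ _), max_le (hpT i hi).2 haT.2⟩
  have hrmono : ∀ i < n, r i ≤ r (i + 1) := fun i hi =>
    max_le_max (hp.2.2 i hi).1.le le_rfl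
  have hrdiff : ∀ i < n, r (i + 1) - r i ≤ p (i + 1) - p i := by
    intro i hi
    have h1 := (hp.2.2 i hi).1
    simp only [hr]
    rcases le_total (p i) a with h2 | h2 <;> rcases le_total (p (i + 1)) a with h3 | h3 <;>
      simp only [max_eq_left, max_eq_right, h2, h3] <;> linarith
  have hsplit : ∀ i < n, tdist M (p i) (x (p i)) (x (p (i + 1)))
      ≤ tdist M (q i) (x (q i)) (x (q (i + 1)))
        + Real.exp (L * h) * tdist M (r i) (x (r i)) (x (r (i + 1))) := by
    intro i hi
    have hpi := (hp.2.2 i hi).1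
    have hph := (hp.2.2 i hi).2
    have hexp : 1 ≤ Real.exp (L * h) := Real.one_le_exp (mul_nonneg hL0 (by linarith))
    have hnn := tdist_nonneg (M := M) (p i) (x (p i)) (x (p (i + 1)))
    simp only [hq, hr]
    rcases le_total (p (i + 1)) a with h1 | h1
    · rw [min_eq_left (hpi.le.trans h1), min_eq_left h1, max_eq_right (hpi.le.trans h1),
        max_eq_right h1, tdist_self]
      simp
    · rcases le_total (p i) a with h2 | h2
      · rw [min_eq_left h2, min_eq_right h1, max_eq_right h2, max_eq_left h1]
        refine (tdist_triangle (p i) _ (x a) _).trans ?_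
        gcongr
        refine (hL a haT (p i) (hpT i hi.le) _ _).trans ?_
        have := tdist_nonneg (M := M) a (x a) (x (p (i + 1)))
        gcongr
        rw [abs_le]
        constructor <;> linarith
      · rw [min_eq_right h2, min_eq_right h1, max_eq_left h2, max_eq_left h1, tdist_self, zero_add]
        nlinarith
  have hfirst : ∑ i ∈ Finset.range n, ENNReal.ofReal (tdist M (q i) (x (q i)) (x (q (i + 1))))
      ≤ meshLength M x h a := by
    -- The truncated nodes stay at `a` from the first index `m` with `a ≤ p m` on, so only the first
    -- `m` steps form a strictly increasing partition of `[0,a]`.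
    have hex : ∃ i, a ≤ p i := ⟨n, by rw [hp.2.1]; exact hab⟩
    classical
    set m := Nat.find hex with hm
    have hmp : a ≤ p m := Nat.find_spec hex
    have hlt : ∀ i < m, p i < a := fun i hi => not_le.1 (Nat.find_min hex hi)
    have hmn : m ≤ n := Nat.find_min' hex (by rw [hp.2.1]; exact hab)
    have hqm : ∀ i, m ≤ i → i ≤ n → q i = a := fun i hi hin =>
      min_eq_right (hmp.trans (hp.mono hi hin))
    have hqpart : IsPartition a h m q := by
      refine ⟨?_, hqm m le_rfl hmn, fun i hi => ?_⟩
      · simp only [hq, hp.1]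
        exact min_eq_left ha
      · have hi' := hp.2.2 i (hi.trans_le hmn)
        have hqi : q i = p i := min_eq_left (hlt i hi).le
        rw [hqi]
        exact ⟨lt_min hi'.1 (hlt i hi), by linarith [min_le_left (p (i + 1)) a]⟩
    refine le_trans (le_of_eq ?_) (hqpart.sum_le_meshLength x)
    symm
    refine Finset.sum_subset (Finset.range_subset_range.2 hmn) fun i hi hni => ?_
    have hi := Finset.mem_range.1 hi
    have hni : m ≤ i := by simpa using hni
    rw [hqm i hni hi.le, hqm (i + 1) (by omega) hi, tdist_self, ENNReal.ofReal_zero]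
  have hsecond : ∑ i ∈ Finset.range n, Real.exp (L * h) * tdist M (r i) (x (r i)) (x (r (i + 1)))
      ≤ Real.exp (2 * L * h) * √((b - a) * (e b - e a)) := by
    have hr0 : r 0 = a := by
      simp only [hr, hp.1]
      exact max_eq_right ha
    have hrn : r n = b := by
      simp only [hr, hp.2.1]
      exact max_eq_left hab
    have hsq : ∑ i ∈ Finset.range n, √((r (i + 1) - r i) * (e (r (i + 1)) - e (r i)))
        ≤ √((b - a) * (e b - e a)) := by
      refine (Finset.sum_sqrt_mul_le _ _ _ (fun i hi => ?_) fun i hi => ?_).trans (le_of_eq ?_)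
      · exact sub_nonneg.2 (hrmono i (Finset.mem_range.1 hi))
      · have hi := Finset.mem_range.1 hi
        exact sub_nonneg.2 (he (hrT i hi.le) (hrT (i + 1) hi) (hrmono i hi))
      · rw [Finset.sum_range_sub, Finset.sum_range_sub (fun i => e (r i)), hr0, hrn]
    calc _ ≤ ∑ i ∈ Finset.range n, Real.exp (2 * L * h) *
            √((r (i + 1) - r i) * (e (r (i + 1)) - e (r i))) := by
          refine Finset.sum_le_sum fun i hi => ?_
          have hi := Finset.mem_range.1 hi
          have h1 := hx (r i) (r (i + 1)) (hrT i hi.le).1 (hrmono i hi) (hrT (i + 1) hi).2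
          have h2 : r (i + 1) - r i ≤ h := (hrdiff i hi).trans (hp.2.2 i hi).2
          calc _ ≤ Real.exp (L * h) * (Real.exp (L * h) *
                √((r (i + 1) - r i) * (e (r (i + 1)) - e (r i)))) := by
                gcongr
                exact h1.trans (by gcongr)
            _ = _ := by
                rw [← mul_assoc, ← Real.exp_add]
                ring_nf
      _ = Real.exp (2 * L * h) *
            ∑ i ∈ Finset.range n, √((r (i + 1) - r i) * (e (r (i + 1)) - e (r i))) :=
          (Finset.mul_sum _ _ _).symm
      _ ≤ _ := by gcongr
  calc _ ≤ ∑ i ∈ Finset.range n, (ENNReal.ofReal (tdist M (q i) (x (q i)) (x (q (i + 1))))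
          + ENNReal.ofReal (Real.exp (L * h) * tdist M (r i) (x (r i)) (x (r (i + 1))))) := by
        refine Finset.sum_le_sum fun i hi => ?_
        rw [← ENNReal.ofReal_add (tdist_nonneg _ _ _)
          (mul_nonneg (Real.exp_pos _).le (tdist_nonneg _ _ _))]
        exact ENNReal.ofReal_le_ofReal (hsplit i (Finset.mem_range.1 hi))
    _ ≤ _ := by
        rw [Finset.sum_add_distrib]
        refine add_le_add hfirst ?_
        rw [← ENNReal.ofReal_sum_of_nonneg fun i _ =>
          mul_nonneg (Real.exp_pos _).le (tdist_nonneg _ _ _)]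
        exact ENNReal.ofReal_le_ofReal hsecond

/-- Letting the mesh tend to 0 removes the exponential. The resulting constant 1 is what makes the
squared speed at most `deriv e`, with no loss. -/
theorem length_le_add (hL0 : 0 ≤ L) (hL : ∀ s ∈ Icc 0 T, ∀ t ∈ Icc 0 T, ∀ x y : X,
      tdist M t x y ≤ Real.exp (L * |t - s|) * tdist M s x y) {e : ℝ → ℝ} {x : ℝ → X}
    (he : MonotoneOn e (Icc 0 T)) (hx : ∀ a b, 0 ≤ a → a ≤ b → b ≤ T →
      tdist M a (x a) (x b) ≤ Real.exp (L * (b - a)) * √((b - a) * (e b - e a)))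
    {a b : ℝ} (ha : 0 ≤ a) (hab : a ≤ b) (hb : b ≤ T) :
    length M x b ≤ length M x a + ENNReal.ofReal √((b - a) * (e b - e a)) := by
  have h1 : ∀ h : ℝ, 0 < h →
      length M x b ≤ meshLength M x h a + ENNReal.ofReal √((b - a) * (e b - e a)) := by
    intro h hh
    have hcont : Continuous fun h' : ℝ =>
        Real.exp (2 * L * h') * √((b - a) * (e b - e a)) := by fun_prop
    have ht := ENNReal.tendsto_ofReal ((hcont.tendsto 0).mono_left
      (nhdsWithin_le_nhds (s := Ioi 0)))
    simp only [mul_zero, Real.exp_zero, one_mul] at ht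
    refine ge_of_tendsto (tendsto_const_nhds.add ht) ?_
    filter_upwards [Ioo_mem_nhdsGT hh] with h' hh'
    calc length M x b ≤ meshLength M x h' b := length_le_meshLength x hh'.1 b
      _ ≤ _ := meshLength_le_add hL0 hL he hx ha hab hb
      _ ≤ _ := by gcongr; exact meshLength_mono x hh'.2.le a
  rw [length_eq_iInf_meshLength x a, ENNReal.iInf₂_add]
  exact le_iInf₂ h1

theorem length_ne_top (hL0 : 0 ≤ L) (hL : ∀ s ∈ Icc 0 T, ∀ t ∈ Icc 0 T, ∀ x y : X,
      tdist M t x y ≤ Real.exp (L * |t - s|) * tdist M s x y) {e : ℝ → ℝ} {x : ℝ → X}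
    (he : MonotoneOn e (Icc 0 T)) (hx : ∀ a b, 0 ≤ a → a ≤ b → b ≤ T →
      tdist M a (x a) (x b) ≤ Real.exp (L * (b - a)) * √((b - a) * (e b - e a)))
    {t : ℝ} (ht : t ∈ Icc 0 T) : length M x t ≠ ⊤ := by
  refine ne_top_of_le_ne_top ?_ (length_le_add hL0 hL he hx le_rfl ht.1 ht.2)
  simp [length_zero]

theorem tdist_le_length_sub (hL0 : 0 ≤ L) (hL : ∀ s ∈ Icc 0 T, ∀ t ∈ Icc 0 T, ∀ x y : X,
      tdist M t x y ≤ Real.exp (L * |t - s|) * tdist M s x y) {e : ℝ → ℝ} {x : ℝ → X}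
    (he : MonotoneOn e (Icc 0 T)) (hx : ∀ a b, 0 ≤ a → a ≤ b → b ≤ T →
      tdist M a (x a) (x b) ≤ Real.exp (L * (b - a)) * √((b - a) * (e b - e a)))
    {a b t : ℝ} (ha : 0 ≤ a) (hab : a ≤ b) (hb : b ≤ T)
    (ht : t ∈ Icc 0 T) :
    tdist M t (x a) (x b)
      ≤ Real.exp (L * T) * ((length M x b).toReal - (length M x a).toReal) := by
  have h1 := length_add_le hL0 hL x ha hab hb ht
  have h2 := ENNReal.toReal_mono (length_ne_top hL0 hL he hx ⟨ha.trans hab, hb⟩) h1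
  rw [ENNReal.toReal_add (length_ne_top hL0 hL he hx ⟨ha, hab.trans hb⟩) ENNReal.ofReal_ne_top,
    ENNReal.toReal_ofReal (mul_nonneg (Real.exp_pos _).le (tdist_nonneg _ _ _)), Real.exp_neg] at h2
  have h3 : (Real.exp (L * T))⁻¹ * tdist M t (x a) (x b)
      ≤ (length M x b).toReal - (length M x a).toReal := by linarith
  rwa [inv_mul_le_iff₀ (Real.exp_pos _)] at h3

theorem abs_length_sub_le (hL0 : 0 ≤ L) (hL : ∀ s ∈ Icc 0 T, ∀ t ∈ Icc 0 T, ∀ x y : X,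
      tdist M t x y ≤ Real.exp (L * |t - s|) * tdist M s x y) {e : ℝ → ℝ} {x : ℝ → X}
    (he : MonotoneOn e (Icc 0 T)) (hx : ∀ a b, 0 ≤ a → a ≤ b → b ≤ T →
      tdist M a (x a) (x b) ≤ Real.exp (L * (b - a)) * √((b - a) * (e b - e a)))
    {a b : ℝ} (ha : 0 ≤ a) (hab : a ≤ b) (hb : b ≤ T) :
    |(length M x b).toReal - (length M x a).toReal| ≤ √((b - a) * (e b - e a)) := by
  have hTa : a ∈ Icc 0 T := ⟨ha, hab.trans hb⟩
  have h1 := length_le_add hL0 hL he hx ha hab hb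
  have hfa := length_ne_top hL0 hL he hx hTa
  have h2 := ENNReal.toReal_mono (ENNReal.add_ne_top.2 ⟨hfa, ENNReal.ofReal_ne_top⟩) h1
  rw [ENNReal.toReal_add hfa ENNReal.ofReal_ne_top,
    ENNReal.toReal_ofReal (Real.sqrt_nonneg _)] at h2
  have h3 := tdist_le_length_sub hL0 hL he hx ha hab hb hTa
  have h4 := nonneg_of_mul_nonneg_right ((tdist_nonneg a (x a) (x b)).trans h3) (Real.exp_pos _)
  rw [abs_of_nonneg h4]
  linarith

/-- Only values of `e` before `t` are bounded by `a`, since `e t` may count a discrete step still in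
progress at `t`. Capping `e` at `a` leaves its derivative on `(0,t)` unchanged and bounds the value
at the endpoint. -/
theorem lintegral_speed_sq_le (hL0 : 0 ≤ L) (hL : ∀ s ∈ Icc 0 T, ∀ t ∈ Icc 0 T, ∀ x y : X,
      tdist M t x y ≤ Real.exp (L * |t - s|) * tdist M s x y) {e : ℝ → ℝ} {x : ℝ → X}
    (he : MonotoneOn e (Icc 0 T)) (hx : ∀ a b, 0 ≤ a → a ≤ b → b ≤ T →
      tdist M a (x a) (x b) ≤ Real.exp (L * (b - a)) * √((b - a) * (e b - e a)))
    {t a : ℝ} (ht : t ∈ Icc 0 T) (ha : ∀ s ∈ Ico 0 t, e s ≤ a) :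
    ∫⁻ r in Ioc 0 t, ENNReal.ofReal (speed M x r ^ 2) ≤ ENNReal.ofReal (a - e 0) := by
  rcases ht.1.eq_or_lt with rfl | ht0
  · simp
  have hf : MonotoneOn (fun s => min (e s) a) (Icc 0 t) := fun r hr s hs hrs =>
    min_le_min_right a (he ⟨hr.1, hr.2.trans ht.2⟩ ⟨hs.1, hs.2.trans ht.2⟩ hrs)
  have hfe : ∀ s ∈ Ico 0 t, min (e s) a = e s := fun s hs => min_eq_left (ha s hs)
  have hle := hf.lintegral_ofReal_deriv_le ht.1
  simp only [hfe 0 ⟨le_rfl, ht0⟩] at hle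
  refine le_trans ?_ (hle.trans (ENNReal.ofReal_le_ofReal (sub_le_sub_right (min_le_right _ _) _)))
  rw [← restrict_Ioo_eq_restrict_Ioc]
  refine lintegral_mono_ae ?_
  rw [ae_restrict_iff' measurableSet_Ioo]
  filter_upwards [ae_deriv_sq_le_of_sub_le_sqrt he
    fun a b ha hab hb => abs_length_sub_le hL0 hL he hx ha hab hb] with r hr hrt
  have heq : (fun s => min (e s) a) =ᶠ[𝓝 r] e := by
    filter_upwards [Ioo_mem_nhds hrt.1 hrt.2] with s hs
    exact hfe s ⟨hs.1.le, hs.2⟩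
  rw [heq.deriv_eq]
  exact ENNReal.ofReal_le_ofReal (hr ⟨hrt.1, hrt.2.trans_le ht.2⟩)

theorem isAC2_of_tdist_le (hL0 : 0 ≤ L) (hL : ∀ s ∈ Icc 0 T, ∀ t ∈ Icc 0 T, ∀ x y : X,
      tdist M t x y ≤ Real.exp (L * |t - s|) * tdist M s x y) {e : ℝ → ℝ} {x : ℝ → X}
    (he : MonotoneOn e (Icc 0 T)) (hx : ∀ a b, 0 ≤ a → a ≤ b → b ≤ T →
      tdist M a (x a) (x b) ≤ Real.exp (L * (b - a)) * √((b - a) * (e b - e a)))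
    (hT : 0 ≤ T) : IsAC2 T M x := by
  intro t ht
  set l : ℝ → ℝ := fun s => (length M x s).toReal with hl
  have hlip : ∀ a b, 0 ≤ a → a ≤ b → b ≤ T → |l b - l a| ≤ √((b - a) * (e b - e a)) :=
    fun a b ha hab hb => abs_length_sub_le hL0 hL he hx ha hab hb
  have hac := absolutelyContinuousOnInterval_of_sub_le_sqrt hT he hlip
  refine ⟨fun r => Real.exp (L * T) * deriv l r, ?_, fun a b ha hab hb => ?_⟩
  · refine MemLp.const_mul ?_ _
    rw [memLp_two_iff_integrable_sq (measurable_deriv l).aestronglyMeasurable]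
    have hei : IntegrableOn (deriv e) (Ioo 0 T) := by
      have h1 : MonotoneOn e (uIcc 0 T) := by rwa [uIcc_of_le hT]
      exact ((intervalIntegrable_iff_integrableOn_Ioc_of_le hT).1
        h1.intervalIntegrable_deriv).mono_set Ioo_subset_Ioc_self
    refine Integrable.mono' hei ((measurable_deriv l).pow_const 2).aestronglyMeasurable ?_
    rw [ae_restrict_iff' measurableSet_Ioo]
    filter_upwards [ae_deriv_sq_le_of_sub_le_sqrt he hlip] with r hr hrt
    rw [Real.norm_of_nonneg (sq_nonneg _)]
    exact hr hrt
  · rw [intervalIntegral.integral_const_mul, (hac.mono (c := a) (d := b) ?_).integral_deriv_eq_sub]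
    · exact tdist_le_length_sub hL0 hL he hx ha hab hb ht
    · rw [uIcc_of_le hab, uIcc_of_le hT]
      exact Icc_subset_Icc ha hb

end DynGradFlow

namespace DynGradFlow

variable {X : Type*} {T K : ℝ} {M : ℝ → MetricSpace X} {E : ℝ → X → EReal}

/-! ### The energy -/

theorem A1.lt_top_iff (h1 : A1 T E) {t : ℝ} (ht : t ∈ Icc 0 T) {x : X} :
    E t x < ⊤ ↔ x ∈ dom E := by
  rw [← h1.2 t ht]
  rfl

theorem A2.ne_bot (h2 : A2 T E) {t : ℝ} (ht : t ∈ Icc 0 T) (x : X) : E t x ≠ ⊥ := by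
  obtain ⟨c, hc⟩ := h2 t ht
  exact ((EReal.bot_lt_coe c).trans_le (hc x)).ne'

theorem coe_toReal_energy (h1 : A1 T E) (h2 : A2 T E) {t : ℝ} (ht : t ∈ Icc 0 T) {x : X}
    (hx : x ∈ dom E) : ((E t x).toReal : EReal) = E t x :=
  EReal.coe_toReal ((h1.lt_top_iff ht).2 hx).ne (h2.ne_bot ht x)

theorem A4.exists_lipschitz (h4 : A4 T E) :
    ∃ K : ℝ, 0 ≤ K ∧ ∀ s ∈ Icc 0 T, ∀ t ∈ Icc 0 T, ∀ x ∈ dom E,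
      |(E t x).toReal - (E s x).toReal| ≤ K * |t - s| := by
  obtain ⟨K, hK⟩ := h4.1
  exact ⟨|K|, abs_nonneg K, fun s hs t ht x hx => (hK s hs t ht x hx).trans
    (mul_le_mul_of_nonneg_right (le_abs_self K) (abs_nonneg _))⟩

theorem mem_dom_and_le_of_isMinOn (h1 : A1 T E) (h2 : A2 T E) {t : ℝ} (ht : t ∈ Icc 0 T)
    {F : X → ℝ} {w : X} (hw : IsMinOn (fun y => E t y + (F y : EReal)) univ w) :
    w ∈ dom E ∧ ∀ y ∈ dom E, (E t w).toReal + F w ≤ (E t y).toReal + F y := by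
  have hle : ∀ y, E t w + (F w : EReal) ≤ E t y + (F y : EReal) := fun y => hw (mem_univ y)
  have hwd : w ∈ dom E := by
    obtain ⟨u, hu⟩ := h1.1
    rw [← h1.lt_top_iff ht]
    by_contra htop
    have h := hle u
    rw [not_lt_top_iff.1 htop, EReal.top_add_coe, ← coe_toReal_energy h1 h2 ht hu,
      ← EReal.coe_add, top_le_iff] at h
    exact EReal.coe_ne_top _ h
  refine ⟨hwd, fun y hy => ?_⟩
  have h := hle y
  rw [← coe_toReal_energy h1 h2 ht hwd, ← coe_toReal_energy h1 h2 ht hy] at h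
  exact_mod_cast h

theorem exists_energy_lower_bound (h2 : A2 T E) (h1 : A1 T E) (hT : 0 ≤ T) (hK0 : 0 ≤ K)
    (hK : ∀ s ∈ Icc 0 T, ∀ t ∈ Icc 0 T, ∀ x ∈ dom E,
      |(E t x).toReal - (E s x).toReal| ≤ K * |t - s|) :
    ∃ c : ℝ, ∀ t ∈ Icc 0 T, ∀ x ∈ dom E, c ≤ (E t x).toReal := by
  have h0 : (0 : ℝ) ∈ Icc 0 T := ⟨le_rfl, hT⟩
  obtain ⟨c, hc⟩ := h2 0 h0
  refine ⟨c - K * T, fun t ht x hx => ?_⟩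
  have h := hc x
  rw [← coe_toReal_energy h1 h2 h0 hx] at h
  have h' : c ≤ (E 0 x).toReal := by exact_mod_cast h
  have h3 := (abs_le.1 (hK 0 h0 t ht x hx)).1
  rw [sub_zero, abs_of_nonneg ht.1] at h3
  nlinarith [ht.2]

theorem abs_timeDeriv_le (hK0 : 0 ≤ K)
    (hK : ∀ s ∈ Icc 0 T, ∀ t ∈ Icc 0 T, ∀ x ∈ dom E,
      |(E t x).toReal - (E s x).toReal| ≤ K * |t - s|) {t : ℝ} (ht : t ∈ Ioo 0 T) {x : X}
    (hx : x ∈ dom E) : |timeDeriv T E t x| ≤ K := by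
  have hn := Icc_mem_nhds ht.1 ht.2
  rw [timeDeriv, derivWithin_of_mem_nhds hn, ← Real.norm_eq_abs]
  refine norm_deriv_le_of_lip' hK0 ?_
  filter_upwards [hn] with s hs
  exact hK t (Ioo_subset_Icc_self ht) s hs x hx

/-- The slope of the energy at a minimizer of `E_t + d_s²(·,u)/(2τ)` is at most `d_s(z,u)/τ`. -/
theorem slope_le_of_isMinOn (h1 : A1 T E) (h2 : A2 T E) {s t τ : ℝ} (ht : t ∈ Icc 0 T)
    (hτ : 0 < τ) {u w : X}
    (hw : IsMinOn (fun y => E t y + ((1 / (2 * τ) * tdist M s y u ^ 2 : ℝ) : EReal)) univ w) :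
    slope M E s t w ≤ ENNReal.ofReal (tdist M s w u / τ) := by
  obtain ⟨hwd, hmin⟩ := mem_dom_and_le_of_isMinOn h1 h2 ht hw
  -- With D = d(w,y) and U = d(w,u), minimality and the triangle inequality give E(w) − E(y) ≤
  -- ((D+U)² − U²)/(2τ) = D(U + D/2)/τ; the term D/2 disappears as y → w.
  have hquot : ∀ y, y ≠ w → (E t w - E t y).toENNReal / ENNReal.ofReal (tdist M s w y)
      ≤ ENNReal.ofReal ((tdist M s w u + tdist M s w y / 2) / τ) := by
    intro y hy
    have hpos : 0 < tdist M s w y := tdist_pos s hy.symm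
    refine ENNReal.div_le_of_le_mul ?_
    by_cases hyd : y ∈ dom E
    · rw [← coe_toReal_energy h1 h2 ht hwd, ← coe_toReal_energy h1 h2 ht hyd, ← EReal.coe_sub,
        EReal.toENNReal_of_ne_top (EReal.coe_ne_top _), EReal.toReal_coe,
        ← ENNReal.ofReal_mul (div_nonneg (add_nonneg (tdist_nonneg _ _ _) (by positivity)) hτ.le)]
      refine ENNReal.ofReal_le_ofReal ?_
      have hm := hmin y hyd
      have htri : tdist M s y u ≤ tdist M s w y + tdist M s w u := by
        rw [tdist_comm s w y]
        exact tdist_triangle s y w u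
      have hyu := tdist_nonneg (M := M) s y u
      have hsq : tdist M s y u ^ 2 ≤ (tdist M s w y + tdist M s w u) ^ 2 := by gcongr
      have hm' : (E t w).toReal - (E t y).toReal
          ≤ 1 / (2 * τ) * (tdist M s y u ^ 2 - tdist M s w u ^ 2) := by linarith
      calc _ ≤ 1 / (2 * τ) * (tdist M s y u ^ 2 - tdist M s w u ^ 2) := hm'
        _ ≤ 1 / (2 * τ) * ((tdist M s w y + tdist M s w u) ^ 2 - tdist M s w u ^ 2) := by gcongr
        _ = _ := by field_simp; ring
    · have htop : E t y = ⊤ := by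
        rw [← h1.lt_top_iff ht] at hyd
        exact not_lt_top_iff.1 hyd
      rw [htop, ← coe_toReal_energy h1 h2 ht hwd, sub_eq_add_neg, EReal.neg_top, EReal.add_bot,
        EReal.toENNReal_bot]
      exact zero_le
  let := M s
  change limsup _ (𝓝[{w}ᶜ] w) ≤ _
  have hcont : Continuous fun y => (tdist M s w u + dist w y / 2) / τ := by fun_prop
  have htend := ENNReal.tendsto_ofReal ((hcont.tendsto w).mono_left
    (nhdsWithin_le_nhds (s := {w}ᶜ)))
  rw [dist_self, zero_div, add_zero] at htend
  -- At an isolated point the limsup is over the trivial filter and equals 0.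
  rcases (𝓝[{w}ᶜ] w).eq_or_neBot with hbot | hne
  · rw [hbot, limsup_bot]
    exact bot_le
  · rw [← htend.limsup_eq]
    refine limsup_le_limsup ?_
    filter_upwards [self_mem_nhdsWithin] with y hy
    exact hquot y hy

/-! ### The discrete scheme -/

/-- The sum `∑_{j < n} d²(S_{j+1}, S_j) / (2h)`. -/
noncomputable def action (T : ℝ) (M : ℝ → MetricSpace X) (h : ℝ) (S : ℕ → X) (n : ℕ) : ℝ :=
  ∑ j ∈ Finset.range n, 1 / (2 * h) * tdist M (min ((j + 1) * h) T) (S (j + 1)) (S j) ^ 2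

variable {h : ℝ} {S : ℕ → X} {z : ℝ → X} {xbar : X}

theorem action_succ (n : ℕ) : action T M h S (n + 1) = action T M h S n
    + 1 / (2 * h) * tdist M (min ((n + 1) * h) T) (S (n + 1)) (S n) ^ 2 :=
  Finset.sum_range_succ _ _

theorem monotone_action (hh : 0 < h) : Monotone (action T M h S) :=
  monotone_nat_of_le_succ fun n => by
    rw [action_succ]
    exact le_add_of_nonneg_right (by positivity)

theorem action_nonneg (hh : 0 < h) (n : ℕ) : 0 ≤ action T M h S n :=
  Finset.sum_nonneg fun _ _ => by positivity

/-- Triangle inequality over the steps between `a` and `b`, then Cauchy–Schwarz. The last node may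
overshoot `b` by less than `h`, which is why `b - a + h` bounds both the total step length and the
time shift of the metrics. -/
theorem tdist_discreteSolution_le {L : ℝ} (hL0 : 0 ≤ L)
    (hL : ∀ s ∈ Icc 0 T, ∀ t ∈ Icc 0 T, ∀ x y : X,
      tdist M t x y ≤ Real.exp (L * |t - s|) * tdist M s x y)
    (hh : 0 < h) {a b : ℝ} (ha : 0 ≤ a) (hab : a ≤ b) (hb : b ≤ T) :
    tdist M a (discreteSolution h S a) (discreteSolution h S b) ≤ Real.exp (L * (b - a + h)) *
      √((b - a + h) * (2 * (action T M h S ⌈b / h⌉₊ - action T M h S ⌈a / h⌉₊))) := by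
  unfold discreteSolution
  set m := ⌈a / h⌉₊ with hm
  obtain ⟨N, hN⟩ := Nat.exists_eq_add_of_le
    (Nat.ceil_mono (div_le_div_of_nonneg_right hab hh.le) : ⌈a / h⌉₊ ≤ ⌈b / h⌉₊)
  rw [← hm] at hN
  have hma : a ≤ m * h := by
    rw [← div_le_iff₀ hh]
    exact Nat.le_ceil _
  have hNb : ((m : ℝ) + N) * h < b + h := by
    have h1 := Nat.ceil_lt_add_one (div_nonneg (ha.trans hab) hh.le)
    rw [hN] at h1
    push_cast at h1
    calc ((m : ℝ) + N) * h < (b / h + 1) * h := by gcongr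
      _ = b + h := by field_simp
  have hact : action T M h S (m + N) - action T M h S m = ∑ j ∈ Finset.range N,
      1 / (2 * h) * tdist M (min ((((m + j : ℕ) : ℝ) + 1) * h) T) (S (m + j + 1)) (S (m + j)) ^ 2 := by
    rw [action, Finset.sum_range_add]
    simp only [action, add_sub_cancel_left]
  rw [hN, hact]
  set D : ℕ → ℝ := fun j =>
    tdist M (min ((((m + j : ℕ) : ℝ) + 1) * h) T) (S (m + j + 1)) (S (m + j)) with hD
  have hstep : ∀ j ∈ Finset.range N, tdist M a (S (m + j)) (S (m + (j + 1)))
      ≤ Real.exp (L * (b - a + h)) * D j := by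
    intro j hj
    have hjN : ((j : ℝ) + 1) ≤ N := by exact_mod_cast Finset.mem_range.1 hj
    have hle : (((m + j : ℕ) : ℝ) + 1) * h < b + h := by
      push_cast
      nlinarith
    have hge : a ≤ (((m + j : ℕ) : ℝ) + 1) * h := by
      push_cast
      nlinarith [Nat.cast_nonneg (α := ℝ) j]
    have hge' : a ≤ min ((((m + j : ℕ) : ℝ) + 1) * h) T := le_min hge (hab.trans hb)
    refine (hL (min ((((m + j : ℕ) : ℝ) + 1) * h) T) ⟨ha.trans hge', min_le_right _ _⟩ a
      ⟨ha, hab.trans hb⟩ _ _).trans ?_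
    rw [tdist_comm, ← add_assoc]
    have hDj : 0 ≤ D j := tdist_nonneg _ _ _
    have habs : |a - min ((((m + j : ℕ) : ℝ) + 1) * h) T| ≤ b - a + h := by
      rw [abs_sub_comm, abs_of_nonneg (sub_nonneg.2 hge')]
      linarith [min_le_left ((((m + j : ℕ) : ℝ) + 1) * h) T]
    change _ * D j ≤ _
    gcongr
  have hsqrt : ∀ j ∈ Finset.range N, D j = √(h * (2 * (1 / (2 * h) * D j ^ 2))) := by
    intro j _
    have : h * (2 * (1 / (2 * h) * D j ^ 2)) = D j ^ 2 := by field_simp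
    rw [this, Real.sqrt_sq (tdist_nonneg _ _ _)]
  calc tdist M a (S m) (S (m + N))
      ≤ ∑ j ∈ Finset.range N, tdist M a (S (m + j)) (S (m + (j + 1))) :=
        tdist_le_range_sum a (fun j => S (m + j)) N
    _ ≤ ∑ j ∈ Finset.range N, Real.exp (L * (b - a + h)) * D j := Finset.sum_le_sum hstep
    _ = Real.exp (L * (b - a + h)) * ∑ j ∈ Finset.range N, √(h * (2 * (1 / (2 * h) * D j ^ 2))) := by
        rw [← Finset.mul_sum, Finset.sum_congr rfl hsqrt]
    _ ≤ _ := by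
        gcongr
        refine (Finset.sum_sqrt_mul_le _ _ _ (fun _ _ => hh.le) fun _ _ => by positivity).trans ?_
        rw [← Finset.mul_sum, Finset.sum_const, Finset.card_range, nsmul_eq_mul]
        have hpos : 0 ≤ ∑ j ∈ Finset.range N, 1 / (2 * h) * D j ^ 2 :=
          Finset.sum_nonneg fun _ _ => by positivity
        gcongr
        linarith

theorem IsMinimizingSequence.step (h1 : A1 T E) (h2 : A2 T E) (hT : 0 < T) (hh : 0 < h)
    (hS : IsMinimizingSequence T M E xbar h S) {n : ℕ} (hn : n * h < T) :
    S (n + 1) ∈ dom E ∧ ∀ y ∈ dom E, (E (min ((n + 1) * h) T) (S (n + 1))).toReal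
        + 1 / (2 * h) * tdist M (min ((n + 1) * h) T) (S (n + 1)) (S n) ^ 2
      ≤ (E (min ((n + 1) * h) T) y).toReal
        + 1 / (2 * h) * tdist M (min ((n + 1) * h) T) y (S n) ^ 2 :=
  mem_dom_and_le_of_isMinOn h1 h2 ⟨le_min (by positivity) hT.le, min_le_right _ _⟩ (hS.2 n hn)

/-- For `n ≥ 1` the bound `n * h < T + h` says exactly that step `n - 1` starts before `T`; it
admits a last node beyond `T`. -/
theorem IsMinimizingSequence.mem_dom (h1 : A1 T E) (h2 : A2 T E) (hT : 0 < T) (hh : 0 < h)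
    (hxbar : xbar ∈ dom E) (hS : IsMinimizingSequence T M E xbar h S)
    {n : ℕ} (hn : n * h < T + h) : S n ∈ dom E := by
  rcases n with _ | n
  · rw [hS.1]
    exact hxbar
  · refine (IsMinimizingSequence.step h1 h2 hT hh hS (n := n) ?_).1
    push_cast at hn
    linarith

/-- Staying at `S n` is a competitor with zero penalty, so each step pays for its action out of the
energy, up to the drift controlled by `K`; the inequalities telescope. -/
theorem IsMinimizingSequence.energy_add_action_le (h1 : A1 T E) (h2 : A2 T E)
    (hK : ∀ s ∈ Icc 0 T, ∀ t ∈ Icc 0 T, ∀ x ∈ dom E,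
      |(E t x).toReal - (E s x).toReal| ≤ K * |t - s|) (hT : 0 < T) (hh : 0 < h)
    (hxbar : xbar ∈ dom E) (hS : IsMinimizingSequence T M E xbar h S)
    {n : ℕ} (hn : n * h < T + h) :
    (E (min (n * h) T) (S n)).toReal + action T M h S n
      ≤ (E 0 xbar).toReal + K * min (n * h) T := by
  induction n with
  | zero => simp [action, hS.1, hT.le]
  | succ n ih =>
    push_cast at hn ⊢
    have hn' : n * h < T := by linarith
    have h3 := ih (by linarith)
    have hSn := IsMinimizingSequence.mem_dom h1 h2 hT hh hxbar hS (n := n) (by linarith)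
    have h4 := (IsMinimizingSequence.step h1 h2 hT hh hS hn').2 (S n) hSn
    have hle : min (n * h) T ≤ min ((n + 1) * h) T := min_le_min_right T (by nlinarith)
    have h5 := (abs_le.1 (hK (min (n * h) T) ⟨le_min (by positivity) hT.le, min_le_right _ _⟩
      (min ((n + 1) * h) T) ⟨le_min (by positivity) hT.le, min_le_right _ _⟩ (S n) hSn)).2
    rw [abs_of_nonneg (sub_nonneg.2 hle)] at h5
    rw [tdist_self] at h4
    rw [action_succ]
    linarith

theorem IsMinimizingSequence.action_le (h1 : A1 T E) (h2 : A2 T E)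
    (hK : ∀ s ∈ Icc 0 T, ∀ t ∈ Icc 0 T, ∀ x ∈ dom E,
      |(E t x).toReal - (E s x).toReal| ≤ K * |t - s|) (hT : 0 < T) (hh : 0 < h)
    (hxbar : xbar ∈ dom E) (hS : IsMinimizingSequence T M E xbar h S) (hK0 : 0 ≤ K) {c : ℝ}
    (hc : ∀ t ∈ Icc 0 T, ∀ x ∈ dom E, c ≤ (E t x).toReal) {n : ℕ} (hn : n * h < T + h) :
    action T M h S n ≤ (E 0 xbar).toReal + K * T - c := by
  have h3 := IsMinimizingSequence.energy_add_action_le h1 h2 hK hT hh hxbar hS hn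
  have h4 := hc (min (n * h) T) ⟨le_min (by positivity) hT.le, min_le_right _ _⟩ (S n)
    (IsMinimizingSequence.mem_dom h1 h2 hT hh hxbar hS hn)
  have h5 : K * min (n * h) T ≤ K * T := mul_le_mul_of_nonneg_left (min_le_right _ _) hK0
  linarith

end DynGradFlow

namespace DynGradFlow

variable {X : Type*} {T K : ℝ} {M : ℝ → MetricSpace X} {E : ℝ → X → EReal}
  {h : ℝ} {S : ℕ → X} {z : ℝ → X} {xbar : X}

/-! ### The variational interpolation -/

/-- Up to the sign and the term `K t`, the energy of the variational interpolation plus the action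
spent so far; here `t ∈ (nh, (n+1)h]`. -/
noncomputable def interpolationGain (T : ℝ) (M : ℝ → MetricSpace X) (E : ℝ → X → EReal) (K h : ℝ)
    (S : ℕ → X) (z : ℝ → X) (t : ℝ) : ℝ :=
  K * t - (E t (z t)).toReal
    - 1 / (2 * (t - (⌈t / h⌉₊ - 1 : ℕ) * h)) *
      tdist M (min (((⌈t / h⌉₊ - 1 : ℕ) + 1) * h) T) (z t) (S (⌈t / h⌉₊ - 1)) ^ 2
    - action T M h S (⌈t / h⌉₊ - 1)

theorem ceil_div_sub_one_eq (hh : 0 < h) {n : ℕ} {t : ℝ} (hn : n * h < t)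
    (hn' : t ≤ (n + 1) * h) : ⌈t / h⌉₊ - 1 = n := by
  have : ⌈t / h⌉₊ = n + 1 := by
    rw [Nat.ceil_eq_iff (Nat.succ_ne_zero n)]
    push_cast
    rw [lt_div_iff₀ hh, div_le_iff₀ hh]
    simpa using ⟨hn, hn'⟩
  omega

theorem exists_step (hh : 0 < h) {t : ℝ} (ht : 0 < t) :
    ∃ n : ℕ, n * h < t ∧ t ≤ (n + 1) * h := by
  have h0 : 0 < ⌈t / h⌉₊ := Nat.ceil_pos.2 (by positivity)
  obtain ⟨n, hn⟩ := Nat.exists_eq_succ_of_ne_zero h0.ne'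
  have := (Nat.ceil_eq_iff (Nat.succ_ne_zero n)).1 hn
  push_cast at this
  rw [lt_div_iff₀ hh, div_le_iff₀ hh] at this
  exact ⟨n, by simpa using this.1, this.2⟩

theorem interpolationGain_eq (hh : 0 < h) {n : ℕ} {t : ℝ} (hn : n * h < t)
    (hn' : t ≤ (n + 1) * h) :
    interpolationGain T M E K h S z t = K * t - (E t (z t)).toReal
      - 1 / (2 * (t - n * h)) * tdist M (min ((n + 1) * h) T) (z t) (S n) ^ 2
      - action T M h S n := by
  rw [interpolationGain, ceil_div_sub_one_eq hh hn hn']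

theorem interpolationGain_zero (hS : S 0 = xbar) (hz : z 0 = S 0) :
    interpolationGain T M E K h S z 0 = -(E 0 xbar).toReal := by
  simp [interpolationGain, action, hz, hS]

theorem interpolationGain_le (hh : 0 < h) {t : ℝ} (ht : 0 ≤ t) :
    interpolationGain T M E K h S z t
      ≤ K * t - (E t (z t)).toReal - action T M h S (⌈t / h⌉₊ - 1) := by
  rcases ht.eq_or_lt with rfl | ht
  · simp [interpolationGain]
  · obtain ⟨n, hn, hn'⟩ := exists_step hh ht
    rw [interpolationGain_eq hh hn hn', ceil_div_sub_one_eq hh hn hn']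
    have : 0 < t - n * h := sub_pos.2 hn
    have : 0 ≤ 1 / (2 * (t - n * h)) * tdist M (min ((n + 1) * h) T) (z t) (S n) ^ 2 := by
      positivity
    linarith

theorem IsVariationalInterpolation.step (h1 : A1 T E) (h2 : A2 T E) (hh : 0 < h)
    (hz : IsVariationalInterpolation T M E h S z)
    {n : ℕ} {t : ℝ} (hn : n * h < t) (hn' : t ≤ (n + 1) * h)
    (ht : t ≤ T) :
    z t ∈ dom E ∧ ∀ y ∈ dom E, (E t (z t)).toReal
        + 1 / (2 * (t - n * h)) * tdist M (min ((n + 1) * h) T) (z t) (S n) ^ 2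
      ≤ (E t y).toReal + 1 / (2 * (t - n * h)) * tdist M (min ((n + 1) * h) T) y (S n) ^ 2 :=
  mem_dom_and_le_of_isMinOn h1 h2 ⟨by nlinarith [Nat.cast_nonneg (α := ℝ) n], ht⟩
    (hz.2 n t hn hn' ht)

theorem IsVariationalInterpolation.mem_dom (h1 : A1 T E) (h2 : A2 T E) (hh : 0 < h)
    (hz : IsVariationalInterpolation T M E h S z) (hS : S 0 ∈ dom E) {t : ℝ} (ht : t ∈ Icc 0 T) :
    z t ∈ dom E := by
  rcases ht.1.eq_or_lt with rfl | h0
  · rwa [hz.1]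
  · obtain ⟨n, hn, hn'⟩ := exists_step hh h0
    exact (IsVariationalInterpolation.step h1 h2 hh hz hn hn' ht.2).1

/-- The earlier point `z s` competes at time `t`: its penalty has a larger denominator there, and `K
* (t - s)` covers the change of its energy. -/
theorem interpolationGain_le_of_step (h1 : A1 T E) (h2 : A2 T E) (hh : 0 < h)
    (hz : IsVariationalInterpolation T M E h S z) (hK : ∀ s ∈ Icc 0 T, ∀ t ∈ Icc 0 T, ∀ x ∈ dom E,
      |(E t x).toReal - (E s x).toReal| ≤ K * |t - s|)
    {n : ℕ} {s t : ℝ} (hs : n * h < s) (hst : s ≤ t)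
    (hn : t ≤ (n + 1) * h) (ht : t ≤ T) :
    interpolationGain T M E K h S z s ≤ interpolationGain T M E K h S z t := by
  rw [interpolationGain_eq hh hs (hst.trans hn), interpolationGain_eq hh (hs.trans_le hst) hn]
  have hs0 : 0 ≤ s := by nlinarith [Nat.cast_nonneg (α := ℝ) n]
  have hzs := (IsVariationalInterpolation.step h1 h2 hh hz hs (hst.trans hn) (hst.trans ht)).1
  have h3 := (IsVariationalInterpolation.step h1 h2 hh hz (hs.trans_le hst) hn ht).2 (z s) hzs
  have h4 := (abs_le.1 (hK s ⟨hs0, hst.trans ht⟩ t ⟨hs0.trans hst, ht⟩ (z s) hzs)).2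
  rw [abs_of_nonneg (sub_nonneg.2 hst)] at h4
  have hpos : 0 < s - n * h := sub_pos.2 hs
  have h5 : 1 / (2 * (t - n * h)) * tdist M (min ((n + 1) * h) T) (z s) (S n) ^ 2
      ≤ 1 / (2 * (s - n * h)) * tdist M (min ((n + 1) * h) T) (z s) (S n) ^ 2 := by gcongr
  linarith

/-- At a node within `[0,T]` the interpolation and the scheme minimize the same functional, so their
values can be compared even if the two minimizers differ. -/
theorem interpolationGain_le_nodeGain (h1 : A1 T E) (h2 : A2 T E) (hh : 0 < h)
    (hz : IsVariationalInterpolation T M E h S z) (hK : ∀ s ∈ Icc 0 T, ∀ t ∈ Icc 0 T, ∀ x ∈ dom E,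
      |(E t x).toReal - (E s x).toReal| ≤ K * |t - s|) (hT : 0 < T)
    (hS : IsMinimizingSequence T M E xbar h S)
    {n : ℕ} {t : ℝ} (hn : n * h < t) (hn' : t ≤ (n + 1) * h)
    (ht : (n + 1) * h ≤ T) :
    interpolationGain T M E K h S z t
      ≤ K * ((n + 1) * h) - (E ((n + 1) * h) (S (n + 1))).toReal - action T M h S (n + 1) := by
  refine (interpolationGain_le_of_step h1 h2 hh hz hK hn hn' le_rfl ht).trans ?_
  have hlt : n * h < (n + 1) * h := by linarith
  rw [interpolationGain_eq hh hlt le_rfl, action_succ]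
  have hd := (IsVariationalInterpolation.step h1 h2 hh hz hlt le_rfl ht).1
  have h3 := (IsMinimizingSequence.step h1 h2 hT hh hS (hlt.trans_le ht)).2 _ hd
  rw [min_eq_left ht] at h3 ⊢
  have h4 : ((n : ℝ) + 1) * h - n * h = h := by ring
  rw [h4]
  linarith

/-- The competitor is the preceding node `S n`, whose penalty vanishes. -/
theorem nodeGain_le_interpolationGain (h1 : A1 T E) (h2 : A2 T E) (hh : 0 < h)
    (hz : IsVariationalInterpolation T M E h S z) (hK : ∀ s ∈ Icc 0 T, ∀ t ∈ Icc 0 T, ∀ x ∈ dom E,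
      |(E t x).toReal - (E s x).toReal| ≤ K * |t - s|) (hT : 0 < T) (hxbar : xbar ∈ dom E)
    (hS : IsMinimizingSequence T M E xbar h S)
    {n : ℕ} {t : ℝ} (hn : n * h < t) (hn' : t ≤ (n + 1) * h)
    (ht : t ≤ T) :
    K * (n * h) - (E (n * h) (S n)).toReal - action T M h S n
      ≤ interpolationGain T M E K h S z t := by
  rw [interpolationGain_eq hh hn hn']
  have hn0 : 0 ≤ n * h := by positivity
  have hSn := IsMinimizingSequence.mem_dom h1 h2 hT hh hxbar hS (n := n) (by linarith)
  have h3 := (IsVariationalInterpolation.step h1 h2 hh hz hn hn' ht).2 (S n) hSn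
  have h4 := (abs_le.1 (hK (n * h) ⟨hn0, hn.le.trans ht⟩ t ⟨hn0.trans hn.le, ht⟩ (S n) hSn)).2
  rw [abs_of_nonneg (sub_nonneg.2 hn.le)] at h4
  rw [tdist_self] at h3
  linarith

theorem nodeGain_mono (h1 : A1 T E) (h2 : A2 T E) (hh : 0 < h)
    (hz : IsVariationalInterpolation T M E h S z) (hK : ∀ s ∈ Icc 0 T, ∀ t ∈ Icc 0 T, ∀ x ∈ dom E,
      |(E t x).toReal - (E s x).toReal| ≤ K * |t - s|) (hT : 0 < T) (hxbar : xbar ∈ dom E)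
    (hS : IsMinimizingSequence T M E xbar h S) {m n : ℕ} (hmn : m ≤ n) (hn : n * h ≤ T) :
    K * (m * h) - (E (m * h) (S m)).toReal - action T M h S m
      ≤ K * (n * h) - (E (n * h) (S n)).toReal - action T M h S n := by
  induction n, hmn using Nat.le_induction with
  | base => exact le_rfl
  | succ n _ ih =>
    push_cast at hn ⊢
    have hlt : n * h < (n + 1) * h := by linarith
    refine (ih (by linarith)).trans ?_
    exact (nodeGain_le_interpolationGain h1 h2 hh hz hK hT hxbar hS hlt le_rfl hn).trans
      (interpolationGain_le_nodeGain h1 h2 hh hz hK hT hS hlt le_rfl hn)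

theorem monotoneOn_interpolationGain (h1 : A1 T E) (h2 : A2 T E) (hh : 0 < h)
    (hz : IsVariationalInterpolation T M E h S z) (hK : ∀ s ∈ Icc 0 T, ∀ t ∈ Icc 0 T, ∀ x ∈ dom E,
      |(E t x).toReal - (E s x).toReal| ≤ K * |t - s|) (hT : 0 < T) (hxbar : xbar ∈ dom E)
    (hS : IsMinimizingSequence T M E xbar h S) :
    MonotoneOn (interpolationGain T M E K h S z) (Icc 0 T) := by
  intro s hs t ht hst
  rcases hs.1.eq_or_lt with rfl | hs0
  · rcases ht.1.eq_or_lt with rfl | ht0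
    · exact le_rfl
    obtain ⟨n, hn, hn'⟩ := exists_step hh ht0
    have h3 := nodeGain_mono h1 h2 hh hz hK hT hxbar hS (Nat.zero_le n) (hn.le.trans ht.2)
    have h4 := nodeGain_le_interpolationGain h1 h2 hh hz hK hT hxbar hS hn hn' ht.2
    rw [interpolationGain_zero hS.1 hz.1]
    simp only [action, Finset.range_zero, Finset.sum_empty, Nat.cast_zero, zero_mul, mul_zero,
      hS.1] at h3
    simp only [action] at h4
    linarith
  · obtain ⟨m, hm, hm'⟩ := exists_step hh hs0
    obtain ⟨n, hn, hn'⟩ := exists_step hh (hs0.trans_le hst)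
    have hmn : m ≤ n := by
      have h3 : (m : ℝ) * h < (n + 1) * h := hm.trans_le (hst.trans hn')
      have h4 : (m : ℝ) < n + 1 := lt_of_mul_lt_mul_right h3 hh.le
      exact Nat.lt_succ_iff.1 (by exact_mod_cast h4)
    rcases hmn.eq_or_lt with rfl | hmn
    · exact interpolationGain_le_of_step h1 h2 hh hz hK hm hst hn' ht.2
    · have hle : ((m : ℝ) + 1) * h ≤ n * h := by
        gcongr
        exact_mod_cast hmn
      have h3 := interpolationGain_le_nodeGain h1 h2 hh hz hK hT hS hm hm'
        (hle.trans (hn.le.trans ht.2))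
      have h4 := nodeGain_mono h1 h2 hh hz hK hT hxbar hS (Nat.succ_le_of_lt hmn)
        (hn.le.trans ht.2)
      have h5 := nodeGain_le_interpolationGain h1 h2 hh hz hK hT hxbar hS hn hn' ht.2
      push_cast at h4
      linarith

/-- An envelope argument: the penalty metric is frozen at the node during a step, so with the
minimizer held fixed only the energy and the step length vary with time. The squared slope bound d/τ
appears as the derivative of the penalty in τ. -/
theorem ae_le_deriv_interpolationGain (h1 : A1 T E) (h2 : A2 T E) (hh : 0 < h)
    (hz : IsVariationalInterpolation T M E h S z) (hK : ∀ s ∈ Icc 0 T, ∀ t ∈ Icc 0 T, ∀ x ∈ dom E,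
      |(E t x).toReal - (E s x).toReal| ≤ K * |t - s|) (hT : 0 < T) (hxbar : xbar ∈ dom E)
    (hS : IsMinimizingSequence T M E xbar h S) (hK0 : 0 ≤ K)
    (hdiff : ∀ᵐ t ∂volume.restrict (Icc 0 T), ∀ x ∈ dom E,
      DifferentiableWithinAt ℝ (fun s => (E s x).toReal) (Icc 0 T) t) :
    ∀ᵐ r, r ∈ Ioo 0 T →
      ENNReal.ofReal (K - timeDeriv T E r (z r))
        + 1 / 2 * slope M E (min (⌈r / h⌉₊ * h) T) r (z r) ^ 2
      ≤ ENNReal.ofReal (deriv (interpolationGain T M E K h S z) r) := by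
  have hmono := monotoneOn_interpolationGain h1 h2 hh hz hK hT hxbar hS
  -- The formula for the gain changes at nodes, a countable set.
  have hnode : ∀ᵐ r : ℝ, r ∉ range fun n : ℕ => (n : ℝ) * h :=
    (countable_range _).ae_notMem volume
  rw [ae_restrict_iff' measurableSet_Icc] at hdiff
  filter_upwards [hdiff, hnode, hmono.ae_differentiableAt_Ioo] with r hEr hrn hΨ hr
  have hrT := Ioo_subset_Icc_self hr
  obtain ⟨n, hn, hn'⟩ := exists_step hh hr.1
  have hn'' : r < (n + 1) * h := by
    refine lt_of_le_of_ne hn' fun heq => hrn ⟨n + 1, ?_⟩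
    rw [heq]
    push_cast
    rfl
  have hceil : (⌈r / h⌉₊ : ℝ) = n + 1 := by
    have h3 := ceil_div_sub_one_eq hh hn hn'
    have h4 : 0 < ⌈r / h⌉₊ := Nat.ceil_pos.2 (div_pos hr.1 hh)
    have h5 : ⌈r / h⌉₊ = n + 1 := by omega
    exact_mod_cast h5
  rw [hceil]
  set τ := r - n * h with hτ
  have hτ0 : 0 < τ := sub_pos.2 hn
  set d := tdist M (min ((n + 1) * h) T) (z r) (S n) with hd
  have hmem := (IsVariationalInterpolation.step h1 h2 hh hz hn hn' hr.2.le).1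
  have hslope := slope_le_of_isMinOn h1 h2 hrT hτ0 (hz.2 n r hn hn' hr.2.le)
  have hderiv : deriv (interpolationGain T M E K h S z) r
      = (K - timeDeriv T E r (z r)) + 1 / 2 * (d / τ) ^ 2 := by
    have hnT := Icc_mem_nhds hr.1 hr.2
    have hE : HasDerivAt (fun s => (E s (z r)).toReal) (timeDeriv T E r (z r)) r := by
      rw [timeDeriv, derivWithin_of_mem_nhds hnT]
      exact ((hEr hrT (z r) hmem).differentiableAt hnT).hasDerivAt
    have hquad : HasDerivAt (fun s : ℝ => 1 / (2 * (s - n * h)) * d ^ 2)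
        (-(1 / 2 * (d / τ) ^ 2)) r := by
      have h3 : HasDerivAt (fun s : ℝ => 2 * (s - n * h)) 2 r := by
        simpa using ((hasDerivAt_id r).sub_const (n * h)).const_mul 2
      have h4 := (h3.fun_inv (by positivity)).mul_const (d ^ 2)
      simp only [one_div]
      convert! h4 using 1
      rw [← hτ]
      field_simp
    have hcomp := ((((hasDerivAt_id r).const_mul K).sub hE).sub hquad).sub_const
      (action T M h S n)
    -- By minimality of `z s`, using `z r` at time `s` can only lower the gain, with equality at `s
    -- = r`. Both functions being differentiable at `r`, their derivatives agree.
    have hmin : IsLocalMin (fun s => interpolationGain T M E K h S z s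
        - (K * s - (E s (z r)).toReal - 1 / (2 * (s - n * h)) * d ^ 2 - action T M h S n)) r := by
      filter_upwards [Ioo_mem_nhds hn hn'', Ioo_mem_nhds hr.1 hr.2] with s hs hs'
      rw [interpolationGain_eq hh hn hn', interpolationGain_eq hh hs.1 hs.2.le]
      have h3 := (IsVariationalInterpolation.step h1 h2 hh hz hs.1 hs.2.le hs'.2.le).2 (z r) hmem
      linarith
    have hzero := hmin.hasDerivAt_eq_zero ((hΨ hr).hasDerivAt.sub hcomp)
    rw [sub_eq_zero] at hzero
    rw [hzero]
    ring
  rw [hderiv]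
  have hnn : 0 ≤ K - timeDeriv T E r (z r) :=
    sub_nonneg.2 ((le_abs_self _).trans (abs_timeDeriv_le hK0 hK hr hmem))
  rw [ENNReal.ofReal_add hnn (by positivity)]
  gcongr
  rw [ENNReal.ofReal_mul (by norm_num), ENNReal.ofReal_pow (div_nonneg (tdist_nonneg _ _ _) hτ0.le)]
  gcongr
  rw [one_div, one_div, ENNReal.ofReal_inv_of_pos (by norm_num), ENNReal.ofReal_ofNat]

end DynGradFlow

/-! ### Limits along the hyperfilter and lower limits -/

/-- One ultrafilter provides limits at all times simultaneously, in place of a Helly selection. It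
refines `atTop`, so limits along `atTop` persist and lower limits can only grow. -/
theorem exists_tendsto_hyperfilter {f : ℕ → ℝ} {a b : ℝ} (hf : ∀ k, f k ∈ Icc a b) :
    ∃ y ∈ Icc a b, Tendsto f (hyperfilter ℕ) (𝓝 y) :=
  isCompact_Icc.ultrafilter_le_nhds ((hyperfilter ℕ).map f)
    (le_principal_iff.2 (Filter.mem_map.2 (Eventually.of_forall hf)))

theorem le_of_le_liminf_of_tendsto_hyperfilter {u v : ℕ → ℝ} {a b : ℝ}
    (ha : (a : EReal) ≤ liminf (fun n => (u n : EReal)) atTop) (huv : ∀ n, u n ≤ v n)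
    (hv : Tendsto v (hyperfilter ℕ) (𝓝 b)) : a ≤ b := by
  have h1 : liminf (fun n => (u n : EReal)) atTop
      ≤ liminf (fun n => (u n : EReal)) (hyperfilter ℕ : Filter ℕ) :=
    liminf_le_liminf_of_le Nat.hyperfilter_le_atTop
  have h2 : liminf (fun n => (u n : EReal)) (hyperfilter ℕ : Filter ℕ)
      ≤ liminf (fun n => (v n : EReal)) (hyperfilter ℕ : Filter ℕ) :=
    liminf_le_liminf (Eventually.of_forall fun n => EReal.coe_le_coe_iff.2 (huv n))
  have h3 := ((continuous_coe_real_ereal.tendsto b).comp hv).liminf_eq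
  have h4 := ha.trans (h1.trans (h2.trans h3.le))
  exact_mod_cast h4

theorem ENNReal.add_liminf_le_liminf_add (u v : ℕ → ℝ≥0∞) :
    liminf u atTop + liminf v atTop ≤ liminf (fun n => u n + v n) atTop := by
  simp only [liminf_eq_iSup_iInf_of_nat]
  rw [ENNReal.iSup_add_iSup_of_monotone]
  · refine iSup_mono fun n => le_iInf₂ fun i hi => add_le_add (iInf₂_le i hi) (iInf₂_le i hi)
  · exact fun m n hmn => biInf_mono fun i hi => hmn.trans hi
  · exact fun m n hmn => biInf_mono fun i hi => hmn.trans hi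

theorem ENNReal.ofReal_sub_le_liminf {u : ℕ → ℝ} {K a : ℝ}
    (h : limsup (fun n => (u n : EReal)) atTop ≤ a) :
    ENNReal.ofReal (K - a) ≤ liminf (fun n => ENNReal.ofReal (K - u n)) atTop := by
  refine le_of_forall_lt fun b hb => ?_
  obtain ⟨c, hbc, hc⟩ := exists_between hb
  refine hbc.trans_le (le_liminf_of_le (by isBoundedDefault) ?_)
  have hctop : c ≠ ⊤ := (hc.trans ENNReal.ofReal_lt_top).ne
  rw [← ENNReal.ofReal_toReal hctop] at hc ⊢
  have hlt : a < K - c.toReal := by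
    have := (ENNReal.ofReal_lt_ofReal_iff_of_nonneg ENNReal.toReal_nonneg).1 hc
    linarith
  have hev := eventually_lt_of_limsup_lt (h.trans_lt (EReal.coe_lt_coe_iff.2 hlt))
  filter_upwards [hev] with n hn
  have := EReal.coe_lt_coe_iff.1 hn
  exact ENNReal.ofReal_le_ofReal (by linarith)

/-! ### Limit of the actions, regularity of the limit curve, measurability of the time derivative.
-/

namespace DynGradFlow

variable {X : Type*} {T K L : ℝ} {M : ℝ → MetricSpace X} {E : ℝ → X → EReal}

theorem ceil_div_mul_lt {h t : ℝ} (hh : 0 < h) (ht : t ∈ Icc 0 T) : ⌈t / h⌉₊ * h < T + h := by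
  have h1 := Nat.ceil_lt_add_one (div_nonneg ht.1 hh.le)
  calc (⌈t / h⌉₊ : ℝ) * h < (t / h + 1) * h := by gcongr
    _ = t + h := by field_simp
    _ ≤ T + h := by linarith [ht.2]

/-- Uniformly bounded actions have ultrafilter limits, and monotonicity in time survives. The factor
2 normalizes the sums to d²/h, so that `deriv e` bounds the squared speed. -/
theorem exists_limit_action {h : ℕ → ℝ} {S : ℕ → ℕ → X} (hh : ∀ k, 0 < h k) {C : ℝ}
    (hC : ∀ k, ∀ n : ℕ, n * h k < T + h k → action T M (h k) (S k) n ≤ C) (hT : 0 ≤ T) :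
    ∃ e : ℝ → ℝ, MonotoneOn e (Icc 0 T) ∧ e 0 = 0 ∧ ∀ t ∈ Icc 0 T,
      Tendsto (fun k => 2 * action T M (h k) (S k) ⌈t / h k⌉₊) (hyperfilter ℕ) (𝓝 (e t)) := by
  have hex : ∀ t ∈ Icc 0 T, ∃ y : ℝ,
      Tendsto (fun k => 2 * action T M (h k) (S k) ⌈t / h k⌉₊) (hyperfilter ℕ) (𝓝 y) := by
    intro t ht
    obtain ⟨y, -, hy⟩ := exists_tendsto_hyperfilter (a := 0) (b := 2 * C)
      (f := fun k => 2 * action T M (h k) (S k) ⌈t / h k⌉₊) fun k =>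
        ⟨by linarith [action_nonneg (T := T) (M := M) (S := S k) (hh k) ⌈t / h k⌉₊],
          by linarith [hC k _ (ceil_div_mul_lt (hh k) ht)]⟩
    exact ⟨y, hy⟩
  choose! e he using hex
  refine ⟨e, fun s hs t ht hst => ?_, ?_, he⟩
  · refine le_of_tendsto_of_tendsto (he s hs) (he t ht) (Eventually.of_forall fun k => ?_)
    have := monotone_action (T := T) (M := M) (S := S k) (hh k)
      (Nat.ceil_mono (div_le_div_of_nonneg_right hst (hh k).le) : ⌈s / h k⌉₊ ≤ ⌈t / h k⌉₊)
    dsimp only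
    linarith
  · refine tendsto_nhds_unique (he 0 ⟨le_rfl, hT⟩) ?_
    simp [action]

theorem tdist_limit_le [TopologicalSpace X] (hσ : IsCompatibleTopology T M) (hL0 : 0 ≤ L)
    (hL : ∀ s ∈ Icc 0 T, ∀ t ∈ Icc 0 T, ∀ x y : X,
      tdist M t x y ≤ Real.exp (L * |t - s|) * tdist M s x y)
    {h : ℕ → ℝ} {S : ℕ → ℕ → X} (hh : ∀ k, 0 < h k) (hh0 : Tendsto h atTop (𝓝 0)) {x : ℝ → X}
    (hx : ∀ t ∈ Icc 0 T, Tendsto (fun k => discreteSolution (h k) (S k) t) atTop (𝓝 (x t)))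
    {e : ℝ → ℝ} (he : ∀ t ∈ Icc 0 T,
      Tendsto (fun k => 2 * action T M (h k) (S k) ⌈t / h k⌉₊) (hyperfilter ℕ) (𝓝 (e t)))
    {a b : ℝ} (ha : 0 ≤ a) (hab : a ≤ b) (hb : b ≤ T) :
    tdist M a (x a) (x b) ≤ Real.exp (L * (b - a)) * √((b - a) * (e b - e a)) := by
  have haT : a ∈ Icc 0 T := ⟨ha, hab.trans hb⟩
  have hbT : b ∈ Icc 0 T := ⟨ha.trans hab, hb⟩
  have hh0' : Tendsto h (hyperfilter ℕ) (𝓝 0) := hh0.mono_left Nat.hyperfilter_le_atTop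
  refine le_of_le_liminf_of_tendsto_hyperfilter (hσ.dist_lsc a haT _ _ _ _ (hx a haT) (hx b hbT))
    (fun k => tdist_discreteSolution_le hL0 hL (hh k) ha hab hb) ?_
  have h1 : Tendsto (fun k => b - a + h k) (hyperfilter ℕ) (𝓝 (b - a)) := by
    simpa using hh0'.const_add (b - a)
  have h2 : Tendsto (fun k => 2 * (action T M (h k) (S k) ⌈b / h k⌉₊
      - action T M (h k) (S k) ⌈a / h k⌉₊)) (hyperfilter ℕ) (𝓝 (e b - e a)) := by
    simp only [mul_sub]
    exact (he b hbT).sub (he a haT)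
  exact ((Real.continuous_exp.tendsto _).comp (h1.const_mul L)).mul
    ((Real.continuous_sqrt.tendsto _).comp (h1.mul h2))

theorem continuousOn_of_tdist_le [TopologicalSpace X] (hT : 0 ≤ T)
    (hσ : IsCompatibleTopology T M) (hL0 : 0 ≤ L)
    (hL : ∀ s ∈ Icc 0 T, ∀ t ∈ Icc 0 T, ∀ x y : X,
      tdist M t x y ≤ Real.exp (L * |t - s|) * tdist M s x y)
    {e : ℝ → ℝ} {x : ℝ → X} (he : MonotoneOn e (Icc 0 T))
    (hx : ∀ a b, 0 ≤ a → a ≤ b → b ≤ T →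
      tdist M a (x a) (x b) ≤ Real.exp (L * (b - a)) * √((b - a) * (e b - e a))) :
    ContinuousOn x (Icc 0 T) := by
  have h0 : (0 : ℝ) ∈ Icc 0 T := ⟨le_rfl, hT⟩
  have hTT : T ∈ Icc 0 T := ⟨hT, le_rfl⟩
  have hle : ∀ a b, 0 ≤ a → a ≤ b → b ≤ T →
      tdist M 0 (x a) (x b) ≤ Real.exp (L * T) * √(|b - a| * (e T - e 0)) := by
    intro a b ha hab hb
    refine (tdist_le_length_sub hL0 hL he hx ha hab hb h0).trans ?_
    gcongr
    refine (le_abs_self _).trans ((abs_length_sub_le hL0 hL he hx ha hab hb).trans ?_)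
    have h1 := he ⟨ha.trans hab, hb⟩ hTT hb
    have h2 := he h0 ⟨ha, hab.trans hb⟩ ha
    rw [abs_of_nonneg (sub_nonneg.2 hab)]
    have h3 := sub_nonneg.2 hab
    gcongr
  intro t ht
  have hnhds : @nhds X (metricTop M 0) (x t) ≤ 𝓝 (x t) :=
    _root_.nhds_mono (TopologicalSpace.le_def.2 fun U hU => hσ.weaker 0 h0 U hU)
  refine Tendsto.mono_right ?_ hnhds
  refine (@tendsto_iff_dist_tendsto_zero X ℝ (M 0).toPseudoMetricSpace _ _ _).2 ?_
  have hbound : Tendsto (fun s => Real.exp (L * T) * √(|s - t| * (e T - e 0))) (𝓝[Icc 0 T] t)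
      (𝓝 0) := by
    have hc : Continuous fun s => Real.exp (L * T) * √(|s - t| * (e T - e 0)) := by fun_prop
    simpa using (hc.tendsto t).mono_left (nhdsWithin_le_nhds (s := Icc 0 T))
  refine squeeze_zero' (Eventually.of_forall fun s => tdist_nonneg (M := M) 0 (x s) (x t)) ?_ hbound
  filter_upwards [self_mem_nhdsWithin] with s hs
  change tdist M 0 (x s) (x t) ≤ _
  rcases le_total s t with hst | hst
  · rw [abs_sub_comm]
    exact hle s t hs.1 hst ht.2
  · rw [tdist_comm]
    exact hle t s ht.1 hst hs.2

/-- The energy frozen at time `θ r` is sequentially lower semicontinuous, and the uniform Lipschitz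
bound pays for moving the time; sequences suffice because the parameter is real. It serves to obtain
Borel measurability. -/
theorem lowerSemicontinuous_energy_comp [TopologicalSpace X] (h1 : A1 T E) (h2 : A2 T E)
    (h3 : A3star T E)
    (hK : ∀ s ∈ Icc 0 T, ∀ t ∈ Icc 0 T, ∀ x ∈ dom E,
      |(E t x).toReal - (E s x).toReal| ≤ K * |t - s|)
    {θ : ℝ → ℝ} {y : ℝ → X} (hθ : Continuous θ) (hθT : ∀ r, θ r ∈ Icc 0 T) (hy : Continuous y)
    (hyd : ∀ r, y r ∈ dom E) : LowerSemicontinuous fun r => (E (θ r) (y r)).toReal := by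
  intro r c hc
  rw [eventually_iff_seq_eventually]
  intro s hs
  obtain ⟨c', hcc', hc'⟩ := exists_between hc
  have hlim := h3 (θ r) (hθT r) (fun n => y (s n)) (y r) ((hy.tendsto r).comp hs)
  rw [← coe_toReal_energy h1 h2 (hθT r) (hyd r)] at hlim
  have hev := eventually_lt_of_lt_liminf ((EReal.coe_lt_coe_iff.2 hc').trans_le hlim)
  have hθs : Tendsto (fun n => K * |θ (s n) - θ r|) atTop (𝓝 0) := by
    have hcont : Continuous fun u => K * |θ u - θ r| := by fun_prop
    simpa [Function.comp_def] using (hcont.tendsto r).comp hs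
  filter_upwards [hev, hθs.eventually_lt_const (sub_pos.2 hcc')] with n hn hn'
  rw [← coe_toReal_energy h1 h2 (hθT r) (hyd (s n)), EReal.coe_lt_coe_iff] at hn
  have h4 := (abs_le.1 (hK (θ r) (hθT r) (θ (s n)) (hθT (s n)) (y (s n)) (hyd (s n)))).1
  linarith

/-- The time derivative is an a.e. limit of difference quotients of the energy with the point `x r`
held fixed, and both energies in each quotient are lower semicontinuous in `r`. The clamp `p` makes
them defined on all of `ℝ`. -/
theorem aemeasurable_timeDeriv_comp [TopologicalSpace X] (hT : 0 ≤ T) (h1 : A1 T E) (h2 : A2 T E)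
    (h3 : A3star T E)
    (hK : ∀ s ∈ Icc 0 T, ∀ t ∈ Icc 0 T, ∀ x ∈ dom E,
      |(E t x).toReal - (E s x).toReal| ≤ K * |t - s|)
    (hdiff : ∀ᵐ t ∂volume.restrict (Icc 0 T), ∀ x ∈ dom E,
      DifferentiableWithinAt ℝ (fun s => (E s x).toReal) (Icc 0 T) t)
    {x : ℝ → X} (hx : ContinuousOn x (Icc 0 T)) (hxd : ∀ t ∈ Icc 0 T, x t ∈ dom E) :
    AEMeasurable (fun r => timeDeriv T E r (x r)) (volume.restrict (Ioc 0 T)) := by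
  set p : ℝ → ℝ := fun r => max 0 (min r T) with hp
  have hpc : Continuous p := by fun_prop
  have hpT : ∀ r, p r ∈ Icc 0 T := fun r => ⟨le_max_left _ _, max_le hT (min_le_right _ _)⟩
  have hpr : ∀ r ∈ Icc 0 T, p r = r := fun r hr => by simp [hp, hr.1, hr.2]
  set y : ℝ → X := fun r => x (p r) with hy
  have hyc : Continuous y := hx.comp_continuous hpc hpT
  have hmeas : ∀ δ : ℝ, Measurable fun r => (E (p (r + δ)) (y r)).toReal := fun δ =>
    (lowerSemicontinuous_energy_comp h1 h2 h3 hK (θ := fun r => p (r + δ)) (by fun_prop)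
      (fun r => hpT _) hyc fun r => hxd _ (hpT r)).measurable
  set δ : ℕ → ℝ := fun n => 1 / ((n : ℝ) + 1) with hδ
  have hδpos : ∀ n, 0 < δ n := fun n => by positivity
  have hδ0 : Tendsto δ atTop (𝓝 0) := tendsto_one_div_add_atTop_nhds_zero_nat
  refine aemeasurable_of_tendsto_metrizable_ae atTop (f := fun n r =>
    (δ n)⁻¹ * ((E (p (r + δ n)) (y r)).toReal - (E (p (r + 0)) (y r)).toReal))
    (fun n => (((hmeas (δ n)).sub (hmeas 0)).const_mul _).aemeasurable) ?_
  rw [← restrict_Ioo_eq_restrict_Ioc, ae_restrict_iff' measurableSet_Ioo]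
  rw [ae_restrict_iff' measurableSet_Icc] at hdiff
  filter_upwards [hdiff] with r hr hrT
  have hrI := Ioo_subset_Icc_self hrT
  have hn := Icc_mem_nhds hrT.1 hrT.2
  have hd : HasDerivAt (fun s => (E s (x r)).toReal) (timeDeriv T E r (x r)) r := by
    rw [timeDeriv, derivWithin_of_mem_nhds hn]
    exact ((hr hrI (x r) (hxd r hrI)).differentiableAt hn).hasDerivAt
  have hlim := hd.tendsto_slope_zero.comp
    (tendsto_nhdsWithin_iff.2 ⟨hδ0, Eventually.of_forall fun n => (hδpos n).ne'⟩)
  refine hlim.congr' ?_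
  filter_upwards [hδ0.eventually_lt_const (sub_pos.2 hrT.2)] with n hn
  have h4 : p (r + δ n) = r + δ n := hpr _ ⟨by linarith [hrT.1, hδpos n], by linarith⟩
  simp only [Function.comp_apply, smul_eq_mul, h4, add_zero, hy, hpr r hrI]

end DynGradFlow

namespace DynGradFlow

variable {X : Type*} {T K : ℝ} {M : ℝ → MetricSpace X} {E : ℝ → X → EReal}

/-! ### Passage to the limit -/

theorem tendsto_min_ceil_mul {h : ℕ → ℝ} (hh : ∀ k, 0 < h k) (hh0 : Tendsto h atTop (𝓝 0))
    {r : ℝ} (hr : r ∈ Icc 0 T) :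
    Tendsto (fun k => min (⌈r / h k⌉₊ * h k) T) atTop (𝓝 r) := by
  have hupper : Tendsto (fun k => r + h k) atTop (𝓝 r) := by simpa using hh0.const_add r
  refine tendsto_of_tendsto_of_tendsto_of_le_of_le tendsto_const_nhds hupper (fun k => ?_)
    fun k => ?_
  · refine le_min ?_ hr.2
    rw [← div_le_iff₀ (hh k)]
    exact Nat.le_ceil _
  · refine (min_le_left _ _).trans ?_
    have h1 := Nat.ceil_lt_add_one (div_nonneg hr.1 (hh k).le)
    have hk := hh k
    calc (⌈r / h k⌉₊ : ℝ) * h k ≤ (r / h k + 1) * h k := by gcongr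
      _ = r + h k := by field_simp

theorem interpolation_energy_le (hT : 0 < T) (h1 : A1 T E) (h2 : A2 T E)
    (hK : ∀ s ∈ Icc 0 T, ∀ t ∈ Icc 0 T, ∀ x ∈ dom E,
      |(E t x).toReal - (E s x).toReal| ≤ K * |t - s|)
    {xbar : X} (hxbar : xbar ∈ dom E) {h : ℝ} {S : ℕ → X} {z : ℝ → X} (hh : 0 < h)
    (hS : IsMinimizingSequence T M E xbar h S) (hz : IsVariationalInterpolation T M E h S z)
    {t : ℝ} (ht : t ∈ Icc 0 T) :
    0 ≤ interpolationGain T M E K h S z t + (E 0 xbar).toReal ∧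
      interpolationGain T M E K h S z t + (E 0 xbar).toReal
        ≤ K * t + (E 0 xbar).toReal - (E t (z t)).toReal - action T M h S (⌈t / h⌉₊ - 1) := by
  have h3 := monotoneOn_interpolationGain h1 h2 hh hz hK hT hxbar hS ⟨le_rfl, hT.le⟩ ht ht.1
  rw [interpolationGain_zero hS.1 hz.1] at h3
  have h4 := interpolationGain_le (T := T) (M := M) (E := E) (K := K) (S := S) (z := z) hh ht.1
  constructor <;> linarith

section

variable [TopologicalSpace X]

theorem limit_mem_dom (h1 : A1 T E) (h2 : A2 T E) (h3 : A3star T E) {t C : ℝ} (ht : t ∈ Icc 0 T)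
    {u : ℕ → X} {y : X} (hu : Tendsto u atTop (𝓝 y)) (hud : ∀ n, u n ∈ dom E)
    (hC : ∀ n, (E t (u n)).toReal ≤ C) : y ∈ dom E := by
  rw [← h1.lt_top_iff ht]
  refine (h3 t ht u y hu).trans_lt (lt_of_le_of_lt (b := (C : EReal)) ?_ (EReal.coe_lt_top C))
  have h4 : liminf (fun n => E t (u n)) atTop ≤ liminf (fun _ : ℕ => (C : EReal)) atTop := by
    refine liminf_le_liminf (Eventually.of_forall fun n => ?_)
    rw [← coe_toReal_energy h1 h2 ht (hud n)]
    exact EReal.coe_le_coe_iff.2 (hC n)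
  simpa using h4

/-- Subtracting from `K` turns the upper semicontinuity of the time derivative into a lower bound of
a nonnegative term. The slopes are taken in the node metrics, whose times converge to `r`, and lower
limits are superadditive. -/
theorem ae_le_liminf_deriv_interpolationGain (hT : 0 < T) (h1 : A1 T E) (h2 : A2 T E)
    (hK0 : 0 ≤ K)
    (hK : ∀ s ∈ Icc 0 T, ∀ t ∈ Icc 0 T, ∀ x ∈ dom E,
      |(E t x).toReal - (E s x).toReal| ≤ K * |t - s|)
    (hdiff : ∀ᵐ t ∂volume.restrict (Icc 0 T), ∀ x ∈ dom E,
      DifferentiableWithinAt ℝ (fun s => (E s x).toReal) (Icc 0 T) t)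
    (husc : ∀ᵐ t ∂volume.restrict (Icc 0 T), ∀ (u : ℕ → X) (y : X),
      (∀ n, u n ∈ dom E) → y ∈ dom E → Tendsto u atTop (𝓝 y) →
      limsup (fun n => (timeDeriv T E t (u n) : EReal)) atTop ≤ (timeDeriv T E t y : EReal))
    (hslope : ∀ t ∈ Icc 0 T, ∀ (s : ℕ → ℝ) (u : ℕ → X) (y : X),
      (∀ n, s n ∈ Icc 0 T) → Tendsto s atTop (𝓝 t) →
      (∀ n, u n ∈ dom E) → y ∈ dom E → Tendsto u atTop (𝓝 y) →
      slope M E t t y ^ 2 ≤ liminf (fun n => slope M E (s n) t (u n) ^ 2) atTop)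
    {xbar : X} (hxbar : xbar ∈ dom E) {h : ℕ → ℝ} {S : ℕ → ℕ → X} {z : ℕ → ℝ → X}
    (hh : ∀ k, 0 < h k) (hh0 : Tendsto h atTop (𝓝 0))
    (hS : ∀ k, IsMinimizingSequence T M E xbar (h k) (S k))
    (hz : ∀ k, IsVariationalInterpolation T M E (h k) (S k) (z k)) {x : ℝ → X}
    (hxd : ∀ t ∈ Icc 0 T, x t ∈ dom E)
    (hx : ∀ t ∈ Icc 0 T, Tendsto (fun k => z k t) atTop (𝓝 (x t))) :
    ∀ᵐ r, r ∈ Ioo 0 T →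
      ENNReal.ofReal (K - timeDeriv T E r (x r)) + 1 / 2 * slope M E r r (x r) ^ 2
      ≤ liminf (fun k => ENNReal.ofReal
          (deriv (interpolationGain T M E K (h k) (S k) (z k)) r)) atTop := by
  have hall := ae_all_iff.2 fun k =>
    ae_le_deriv_interpolationGain h1 h2 (hh k) (hz k) hK hT hxbar (hS k) hK0 hdiff
  rw [ae_restrict_iff' measurableSet_Icc] at husc
  filter_upwards [hall, husc] with r hr hru hrT
  have hrI := Ioo_subset_Icc_self hrT
  have hzd : ∀ k, z k r ∈ dom E := fun k =>
    IsVariationalInterpolation.mem_dom h1 h2 (hh k) (hz k) (by rwa [(hS k).1]) hrI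
  have hA := ENNReal.ofReal_sub_le_liminf (K := K)
    (hru hrI (fun k => z k r) (x r) hzd (hxd r hrI) (hx r hrI))
  have hB := hslope r hrI (fun k => min (⌈r / h k⌉₊ * h k) T) (fun k => z k r) (x r)
    (fun k => ⟨le_min (mul_nonneg (Nat.cast_nonneg _) (hh k).le) hT.le, min_le_right _ _⟩)
    (tendsto_min_ceil_mul hh hh0 hrI) hzd (hxd r hrI) (hx r hrI)
  calc _ ≤ liminf (fun k => ENNReal.ofReal (K - timeDeriv T E r (z k r))) atTop
        + 1 / 2 * liminf (fun k => slope M E (min (⌈r / h k⌉₊ * h k) T) r (z k r) ^ 2) atTop := by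
        gcongr
    _ = liminf (fun k => ENNReal.ofReal (K - timeDeriv T E r (z k r))) atTop + liminf
          (fun k => 1 / 2 * slope M E (min (⌈r / h k⌉₊ * h k) T) r (z k r) ^ 2) atTop := by
        rw [ENNReal.liminf_const_mul_of_ne_top (by simp)]
    _ ≤ _ := ENNReal.add_liminf_le_liminf_add _ _
    _ ≤ _ := liminf_le_liminf (Eventually.of_forall fun k => hr k hrT)

/-- The limit of the discrete energy inequalities: `a` is the limit of the actions. -/
theorem exists_lintegral_liminf_deriv_le (hT : 0 < T) (h1 : A1 T E) (h2 : A2 T E)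
    (h3 : A3star T E)
    (hK : ∀ s ∈ Icc 0 T, ∀ t ∈ Icc 0 T, ∀ x ∈ dom E,
      |(E t x).toReal - (E s x).toReal| ≤ K * |t - s|)
    {c : ℝ} (hc : ∀ t ∈ Icc 0 T, ∀ x ∈ dom E, c ≤ (E t x).toReal)
    {xbar : X} (hxbar : xbar ∈ dom E) {h : ℕ → ℝ} {S : ℕ → ℕ → X} {z : ℕ → ℝ → X}
    (hh : ∀ k, 0 < h k) (hh0 : Tendsto h atTop (𝓝 0))
    (hS : ∀ k, IsMinimizingSequence T M E xbar (h k) (S k))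
    (hz : ∀ k, IsVariationalInterpolation T M E (h k) (S k) (z k))
    {e : ℝ → ℝ} (he : ∀ t ∈ Icc 0 T,
      Tendsto (fun k => 2 * action T M (h k) (S k) ⌈t / h k⌉₊) (hyperfilter ℕ) (𝓝 (e t)))
    {t : ℝ} (ht : t ∈ Icc 0 T) {y : X} (hyd : y ∈ dom E)
    (hy : Tendsto (fun k => z k t) atTop (𝓝 y)) :
    ∃ a : ℝ, 0 ≤ a ∧ (∀ s ∈ Ico 0 t, e s ≤ 2 * a) ∧
      0 ≤ K * t + (E 0 xbar).toReal - (E t y).toReal - a ∧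
      ∫⁻ r in Ioc 0 t, liminf (fun k => ENNReal.ofReal
          (deriv (interpolationGain T M E K (h k) (S k) (z k)) r)) atTop
        ≤ ENNReal.ofReal (K * t + (E 0 xbar).toReal - (E t y).toReal - a) := by
  set E0 := (E 0 xbar).toReal with hE0
  -- The index leaves out the step containing `t`: the gain at `t` accounts for that step through
  -- the current penalty instead.
  set A : ℕ → ℝ := fun k => action T M (h k) (S k) (⌈t / h k⌉₊ - 1) with hA
  have hzd : ∀ k, z k t ∈ dom E := fun k =>
    IsVariationalInterpolation.mem_dom h1 h2 (hh k) (hz k) (by rwa [(hS k).1]) ht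
  have hgain : ∀ k, 0 ≤ interpolationGain T M E K (h k) (S k) (z k) t + E0 ∧
      interpolationGain T M E K (h k) (S k) (z k) t + E0
        ≤ K * t + E0 - (E t (z k t)).toReal - A k := fun k =>
    interpolation_energy_le hT h1 h2 hK hxbar (hh k) (hS k) (hz k) ht
  have hA0 : ∀ k, 0 ≤ A k := fun k => action_nonneg (hh k) _
  obtain ⟨a, ha0, ha⟩ := exists_tendsto_hyperfilter (a := 0) (b := K * t + E0 - c) (f := A)
    fun k => ⟨hA0 k, by linarith [hgain k, hc t ht _ (hzd k)]⟩
  obtain ⟨b, -, hb⟩ := exists_tendsto_hyperfilter (a := c) (b := K * t + E0)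
    (f := fun k => (E t (z k t)).toReal)
    fun k => ⟨hc t ht _ (hzd k), by linarith [hgain k, hA0 k]⟩
  have hyb : (E t y).toReal ≤ b := by
    refine le_of_le_liminf_of_tendsto_hyperfilter ?_ (fun k => le_refl (E t (z k t)).toReal) hb
    simp only [coe_toReal_energy h1 h2 ht hyd, coe_toReal_energy h1 h2 ht (hzd _)]
    exact h3 t ht _ y hy
  have hlim : Tendsto (fun k => K * t + E0 - (E t (z k t)).toReal - A k) (hyperfilter ℕ)
      (𝓝 (K * t + E0 - b - a)) := (hb.const_sub _).sub ha
  have hnn : 0 ≤ K * t + E0 - b - a :=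
    ge_of_tendsto' hlim fun k => (hgain k).1.trans (hgain k).2
  refine ⟨a, ha0.1, fun s hs => ?_, by linarith, ?_⟩
  · have hsT : s ∈ Icc 0 T := ⟨hs.1, hs.2.le.trans ht.2⟩
    refine le_of_tendsto_of_tendsto (he s hsT) (ha.const_mul 2) ?_
    -- Once `h k < t - s`, the step containing `s` precedes the one containing `t`, so its action is
    -- already counted in `A k`.
    have hsmall := (hh0.eventually_lt_const (sub_pos.2 hs.2)).filter_mono Nat.hyperfilter_le_atTop
    filter_upwards [hsmall] with k hk
    have hidx : ⌈s / h k⌉₊ ≤ ⌈t / h k⌉₊ - 1 := by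
      refine Nat.le_sub_one_of_lt (Nat.lt_ceil.2 ?_)
      refine (Nat.ceil_lt_add_one (div_nonneg hs.1 (hh k).le)).trans ?_
      rw [div_add_one (hh k).ne']
      exact div_lt_div_of_pos_right (by linarith) (hh k)
    exact mul_le_mul_of_nonneg_left (monotone_action (hh k) hidx) zero_le_two
  · have hfatou := lintegral_liminf_le (μ := volume.restrict (Ioc 0 t)) (u := atTop)
      (f := fun k r => ENNReal.ofReal (deriv (interpolationGain T M E K (h k) (S k) (z k)) r))
      fun k => (measurable_deriv _).ennreal_ofReal
    refine hfatou.trans ?_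
    have hk : ∀ k, ∫⁻ r in Ioc 0 t,
        ENNReal.ofReal (deriv (interpolationGain T M E K (h k) (S k) (z k)) r)
          ≤ ENNReal.ofReal (K * t + E0 - (E t (z k t)).toReal - A k) := by
      intro k
      have hmono := (monotoneOn_interpolationGain h1 h2 (hh k) (hz k) hK hT hxbar (hS k)).mono
        (Icc_subset_Icc_right ht.2)
      refine (hmono.lintegral_ofReal_deriv_le ht.1).trans (ENNReal.ofReal_le_ofReal ?_)
      rw [interpolationGain_zero (hS k).1 (hz k).1, sub_neg_eq_add]
      exact (hgain k).2
    calc _ ≤ liminf (fun k => ENNReal.ofReal (K * t + E0 - (E t (z k t)).toReal - A k)) atTop :=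
          liminf_le_liminf (Eventually.of_forall hk)
      _ ≤ liminf (fun k => ENNReal.ofReal (K * t + E0 - (E t (z k t)).toReal - A k))
            (hyperfilter ℕ : Filter ℕ) := liminf_le_liminf_of_le Nat.hyperfilter_le_atTop
      _ = ENNReal.ofReal (K * t + E0 - b - a) := (ENNReal.tendsto_ofReal hlim).liminf_eq
      _ ≤ _ := ENNReal.ofReal_le_ofReal (by linarith)

end

/-- A nonnegative function dominated by the difference of two measurable ones. -/
theorem half_upperLIntegral_add_lintegral_le {α : Type*} [MeasurableSpace α] {μ : Measure α}
    {f g m : α → ℝ≥0∞} (hg : AEMeasurable g μ) (hm : Measurable m) (hg' : ∫⁻ a, g a ∂μ ≠ ⊤)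
    (h : ∀ᵐ a ∂μ, g a + 1 / 2 * f a ≤ m a) :
    1 / 2 * upperLIntegral μ f + ∫⁻ a, g a ∂μ ≤ ∫⁻ a, m a ∂μ := by
  have hgm : g ≤ᵐ[μ] m := h.mono fun a ha => le_self_add.trans ha
  have hsub : Measurable fun a => m a - hg.mk g a := hm.sub hg.measurable_mk
  have hle : upperLIntegral μ f ≤ ∫⁻ a, 2 * (m a - hg.mk g a) ∂μ := by
    -- Twice the difference of `m` and a measurable version of `g` is a measurable majorant of `f`;
    -- the subtraction is legitimate because `g` is a.e. finite.
    refine iInf_le_of_le _ (iInf_le_of_le (hsub.const_mul 2)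
      (iInf_le_of_le ?_ le_rfl))
    filter_upwards [h, hg.ae_eq_mk, ae_lt_top' hg hg'] with a ha hga hgt
    rw [← hga]
    have h3 : 1 / 2 * f a ≤ m a - g a := ENNReal.le_sub_of_add_le_left hgt.ne ha
    calc f a = 2 * (1 / 2 * f a) := by
          rw [← mul_assoc, one_div, ENNReal.mul_inv_cancel two_ne_zero ENNReal.ofNat_ne_top, one_mul]
      _ ≤ _ := by gcongr
  have hintegral : ∫⁻ a, 2 * (m a - hg.mk g a) ∂μ = 2 * (∫⁻ a, m a ∂μ - ∫⁻ a, g a ∂μ) := by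
    rw [lintegral_const_mul _ hsub, ← lintegral_sub' hg hg' hgm]
    congr 1
    refine lintegral_congr_ae ?_
    filter_upwards [hg.ae_eq_mk] with a ha
    rw [ha]
  calc _ ≤ 1 / 2 * (2 * (∫⁻ a, m a ∂μ - ∫⁻ a, g a ∂μ)) + ∫⁻ a, g a ∂μ := by
        gcongr
        exact hle.trans hintegral.le
    _ = ∫⁻ a, m a ∂μ - ∫⁻ a, g a ∂μ + ∫⁻ a, g a ∂μ := by
        rw [← mul_assoc, one_div, ENNReal.inv_mul_cancel two_ne_zero ENNReal.ofNat_ne_top, one_mul]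
    _ = _ := tsub_add_cancel_of_le (lintegral_mono_ae hgm)

end DynGradFlow

/-! ### The energy inequality. -/

theorem mainTheorem7 {X : Type*} [TopologicalSpace X] (T : ℝ) (hT : 0 < T)
    (M : ℝ → MetricSpace X) (E : ℝ → X → EReal)
    (hM : DynGradFlow.IsTimeDependentMetric T M)
    (hσ : DynGradFlow.IsCompatibleTopology T M)
    (h1 : DynGradFlow.A1 T E) (h2 : DynGradFlow.A2 T E) (h3 : DynGradFlow.A3star T E)
    (h4 : DynGradFlow.A4 T E) (h5 : DynGradFlow.A5 T M)
    (husc : ∀ᵐ t ∂volume.restrict (Icc 0 T), ∀ (u : ℕ → X) (y : X),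
      (∀ n, u n ∈ DynGradFlow.dom E) → y ∈ DynGradFlow.dom E → Tendsto u atTop (𝓝 y) →
      limsup (fun n => (DynGradFlow.timeDeriv T E t (u n) : EReal)) atTop
        ≤ (DynGradFlow.timeDeriv T E t y : EReal))
    (hslope : ∀ t ∈ Icc 0 T, ∀ (s : ℕ → ℝ) (u : ℕ → X) (y : X),
      (∀ n, s n ∈ Icc 0 T) → Tendsto s atTop (𝓝 t) →
      (∀ n, u n ∈ DynGradFlow.dom E) → y ∈ DynGradFlow.dom E → Tendsto u atTop (𝓝 y) →
      DynGradFlow.slope M E t t y ^ 2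
        ≤ liminf (fun n => DynGradFlow.slope M E (s n) t (u n) ^ 2) atTop)
    (xbar : X) (hxbar : xbar ∈ DynGradFlow.dom E)
    (x : ℝ → X) (hx : DynGradFlow.IsLimitCurve T M E xbar x) :
    DynGradFlow.IsAC2 T M x ∧
    IntervalIntegrable (fun r => DynGradFlow.timeDeriv T E r (x r)) volume 0 T ∧
    ∀ t ∈ Icc 0 T,
      E t (x t)
        + ((1 / 2 * ∫⁻ r in Ioc 0 t, ENNReal.ofReal (DynGradFlow.speed M x r ^ 2) : ℝ≥0∞) : EReal)
        + ((1 / 2 * DynGradFlow.upperLIntegral (volume.restrict (Ioc 0 t))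
              (fun r => DynGradFlow.slope M E r r (x r) ^ 2) : ℝ≥0∞) : EReal)
      ≤ E 0 xbar + ((∫ r in (0 : ℝ)..t, DynGradFlow.timeDeriv T E r (x r) : ℝ) : EReal) := by
  open DynGradFlow in
  obtain ⟨L, hL0, hL⟩ := hM.exists_tdist_le
  obtain ⟨K, hK0, hK⟩ := h4.exists_lipschitz
  obtain ⟨c, hc⟩ := exists_energy_lower_bound h2 h1 hT.le hK0 hK
  obtain ⟨h, S, z, hh, hh0, hS, hz, hlim⟩ := hx
  have h0T : (0 : ℝ) ∈ Icc 0 T := ⟨le_rfl, hT.le⟩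
  obtain ⟨e, he, he0, hetend⟩ := exists_limit_action (T := T) (M := M) (S := S) hh
    (fun k n hn => IsMinimizingSequence.action_le h1 h2 hK hT (hh k) hxbar (hS k) hK0 hc hn) hT.le
  have hxe : ∀ a b, 0 ≤ a → a ≤ b → b ≤ T →
      tdist M a (x a) (x b) ≤ Real.exp (L * (b - a)) * √((b - a) * (e b - e a)) :=
    fun a b ha hab hb =>
      tdist_limit_le hσ hL0 hL hh hh0 (fun t ht => (hlim t ht).1) hetend ha hab hb
  have hxd : ∀ t ∈ Icc 0 T, x t ∈ dom E := fun t ht =>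
    limit_mem_dom h1 h2 h3 ht (hlim t ht).2 (C := K * t + (E 0 xbar).toReal)
      (fun k => IsVariationalInterpolation.mem_dom h1 h2 (hh k) (hz k)
        (by rwa [(hS k).1]) ht)
      fun k => by
        have h6 := interpolation_energy_le hT h1 h2 hK hxbar (hh k) (hS k) (hz k) ht
        have h7 := action_nonneg (T := T) (M := M) (S := S k) (hh k) (⌈t / h k⌉₊ - 1)
        linarith
  have hmeas : AEMeasurable (fun r => timeDeriv T E r (x r)) (volume.restrict (Ioc 0 T)) :=
    aemeasurable_timeDeriv_comp hT.le h1 h2 h3 hK h4.2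
      (continuousOn_of_tdist_le hT.le hσ hL0 hL he hxe) hxd
  have hbound : ∀ᵐ r ∂volume.restrict (Ioc 0 T), |timeDeriv T E r (x r)| ≤ K := by
    rw [← restrict_Ioo_eq_restrict_Ioc]
    filter_upwards [ae_restrict_mem measurableSet_Ioo] with r hr
    exact abs_timeDeriv_le hK0 hK hr (hxd r (Ioo_subset_Icc_self hr))
  have hintegral : IntegrableOn (fun r => timeDeriv T E r (x r)) (Ioc 0 T) :=
    Integrable.of_bound hmeas.aestronglyMeasurable K hbound
  refine ⟨isAC2_of_tdist_le hL0 hL he hxe hT.le,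
    (intervalIntegrable_iff_integrableOn_Ioc_of_le hT.le).2 hintegral, fun t ht => ?_⟩
  obtain ⟨a, ha0, hae, hR, hI⟩ := exists_lintegral_liminf_deriv_le hT h1 h2 h3 hK hc hxbar
    hh hh0 hS hz hetend ht (hxd t ht) (hlim t ht).2
  have hsub : Ioc 0 t ⊆ Ioc 0 T := Ioc_subset_Ioc_right ht.2
  have hintt : IntegrableOn (fun r => timeDeriv T E r (x r)) (Ioc 0 t) := hintegral.mono_set hsub
  have hnn : ∀ᵐ r ∂volume.restrict (Ioc 0 t), 0 ≤ K - timeDeriv T E r (x r) :=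
    (ae_restrict_of_ae_restrict_of_subset hsub hbound).mono fun r hr =>
      sub_nonneg.2 ((le_abs_self _).trans hr)
  have hKint : IntegrableOn (fun _ : ℝ => K) (Ioc 0 t) := integrableOn_const (by simp)
  have hdiffint : IntegrableOn (fun r => K - timeDeriv T E r (x r)) (Ioc 0 t) := hKint.sub hintt
  -- The artificial term `K * t` reappears here and cancels against the one in `hI`.
  have hW : ∫⁻ r in Ioc 0 t, ENNReal.ofReal (K - timeDeriv T E r (x r))
      = ENNReal.ofReal (K * t - ∫ r in (0 : ℝ)..t, timeDeriv T E r (x r)) := by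
    rw [← ofReal_integral_eq_lintegral_ofReal hdiffint hnn, integral_sub hKint hintt,
      intervalIntegral.integral_of_le ht.1]
    simp [ht.1, mul_comm]
  have hWnn : 0 ≤ K * t - ∫ r in (0 : ℝ)..t, timeDeriv T E r (x r) := by
    have h6 := integral_nonneg_of_ae hnn
    rw [integral_sub hKint hintt] at h6
    rw [intervalIntegral.integral_of_le ht.1]
    simpa [ht.1, mul_comm] using h6
  have hpt : ∀ᵐ r ∂volume.restrict (Ioc 0 t),
      ENNReal.ofReal (K - timeDeriv T E r (x r)) + 1 / 2 * slope M E r r (x r) ^ 2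
        ≤ liminf (fun k => ENNReal.ofReal
          (deriv (interpolationGain T M E K (h k) (S k) (z k)) r)) atTop := by
    rw [← restrict_Ioo_eq_restrict_Ioc, ae_restrict_iff' measurableSet_Ioo]
    filter_upwards [ae_le_liminf_deriv_interpolationGain hT h1 h2 hK0 hK h4.2 husc hslope hxbar
      hh hh0 hS hz hxd fun t ht => (hlim t ht).2] with r hr hrt
    exact hr ⟨hrt.1, hrt.2.trans_le ht.2⟩
  have hU := (half_upperLIntegral_add_lintegral_le
    hdiffint.aemeasurable.ennreal_ofReal
    (Measurable.liminf fun k => (measurable_deriv _).ennreal_ofReal)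
    (by rw [hW]; exact ENNReal.ofReal_ne_top) hpt).trans hI
  have hP := lintegral_speed_sq_le hL0 hL he hxe ht hae
  set P := ∫⁻ r in Ioc 0 t, ENNReal.ofReal (speed M x r ^ 2)
  set U := 1 / 2 * upperLIntegral (volume.restrict (Ioc 0 t)) fun r => slope M E r r (x r) ^ 2
  have hP' : 1 / 2 * P ≤ ENNReal.ofReal a := by
    calc 1 / 2 * P ≤ ENNReal.ofReal (1 / 2) * ENNReal.ofReal (2 * a - e 0) := by
          gcongr
          rw [one_div, one_div, ENNReal.ofReal_inv_of_pos (by norm_num), ENNReal.ofReal_ofNat]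
      _ = ENNReal.ofReal a := by
          rw [← ENNReal.ofReal_mul (by norm_num), he0]
          ring_nf
  rw [hW] at hU
  -- All quantities are finite, so both estimates pass to real numbers, where adding them eliminates
  -- `a`.
  have hUtop : U ≠ ⊤ := ne_top_of_le_ne_top ENNReal.ofReal_ne_top (le_self_add.trans hU)
  have hPtop : 1 / 2 * P ≠ ⊤ := ne_top_of_le_ne_top ENNReal.ofReal_ne_top hP'
  have hUr := ENNReal.toReal_mono ENNReal.ofReal_ne_top hU
  rw [ENNReal.toReal_add hUtop ENNReal.ofReal_ne_top, ENNReal.toReal_ofReal hWnn,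
    ENNReal.toReal_ofReal hR] at hUr
  have hPr := ENNReal.toReal_mono ENNReal.ofReal_ne_top hP'
  rw [ENNReal.toReal_ofReal ha0] at hPr
  rw [← EReal.coe_ennreal_toReal hUtop, ← EReal.coe_ennreal_toReal hPtop,
    ← coe_toReal_energy h1 h2 ht (hxd t ht), ← coe_toReal_energy h1 h2 h0T hxbar]
  norm_cast
  linarith
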